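/- Let $n,q\ge 1$, let $0\le r\le\infty$, and let $M$ be a smooth manifold of dimension $2n+q$. A $q$-contact structure on $M$ with forms of class $C^{r+1}$ consists of $q$ pointwise linearly independent $1$-forms $\lambda_1,\dots,\lambda_q$ of class $C^{r+1}$ and a splitting $TM=\mathcal R\oplus\xi$ of class $C^1$ such that $\xi=\bigcap_i\ker\lambda_i$ and, for every $i$, the restriction $d\lambda_i|_\xi$ is non-degenerate and $\ker d\lambda_i=\mathcal R$. Its contact foliation $\mathcal F$ is the $q$-dimensional foliation tangent to $\mathcal R$ (its leaves are the orbits of the commuting Reeb vector fields $R_j\in\mathcal R$, $\lambda_i(R_j)=\delta_{ij}$). Suppose that $\mathcal F$ has codimension $2$, that is, $\dim M=2+q$. Then every point of $M$ has an open neighbourhood $U$ with coordinates $(x,y,z_1,\dots,z_q)$ of class $C^r$ (a homeomorphism from $U$ onto an open subset of $\mathbb R^{2+q}$ which is of class $C^r$ together with its inverse), where $y,z_1,\dots,z_q$ are of class at least $C^1$ (also when $r=0$), and there are functions $a_1,\dots,a_q:U\to\mathbb R$ of class $C^r$, each constant on the leaves of the restricted foliation $\mathcal F|_U$, such that for every $i$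 the partial derivative $\partial_x a_i$ exists and is nowhere zero on $U$, and $$\lambda_i=dz_i+a_i\,dy\quad\text{on }U .$$ Moreover, the coordinates and functions can be chosen so that $a_1=x$. In particular, if the $\lambda_i$ are smooth, then the coordinates and the $a_i$ can be chosen smooth. -/

import Mathlib

open Set Module
open scoped Manifold ContDiff

noncomputable section

namespace ContactFoliation

variable {E : Type*} [NormedAddCommGroup E] [NormedSpace ℝ E]
  {M : Type*} [TopologicalSpace M] [ChartedSpace E M]

/-- A differential `1`-form on `M`, with no regularity assumed. -/
abbrev OneForm (E : Type*) [NormedAddCommGroup E] [NormedSpace ℝ E]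
    (M : Type*) [TopologicalSpace M] [ChartedSpace E M] :=
  ∀ p : M, TangentSpace 𝓘(ℝ, E) p →L[ℝ] ℝ

/-- The `1`-form `η` is of class `C^k`: it is a `C^k` section of the cotangent bundle
`Hom(TM, ℝ)`. -/
def IsOneFormOfClass [IsManifold 𝓘(ℝ, E) ∞ M] (k : ℕ∞) (η : OneForm E M) : Prop :=
  ContMDiff 𝓘(ℝ, E) (𝓘(ℝ, E).prod 𝓘(ℝ, E →L[ℝ] ℝ)) k
    (fun p : M => Bundle.TotalSpace.mk' (E →L[ℝ] ℝ)
      (E := fun p : M => TangentSpace 𝓘(ℝ, E) p →L[ℝ] Bundle.Trivial M ℝ p) p (η p))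

/-- The differential `df` of a real-valued function on `M`, as a `1`-form. -/
def differential (f : M → ℝ) : OneForm E M := fun p => mfderiv 𝓘(ℝ, E) 𝓘(ℝ, ℝ) f p

/-- The expression of `η` in the preferred chart at `p`, that is, the pullback of `η` under the
inverse of that chart. -/
def oneFormInChart (η : OneForm E M) (p : M) : E → E →L[ℝ] ℝ := fun x =>
  (η ((extChartAt 𝓘(ℝ, E) p).symm x)).comp
    (mfderiv 𝓘(ℝ, E) 𝓘(ℝ, E) (extChartAt 𝓘(ℝ, E) p).symm x)

/-- The exterior derivative `dη` of a `1`-form at `p`, evaluated at `v, w ∈ T_p M`. It is computed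
in the preferred chart at `p` by `dη(v, w) = (D_v η)(w) - (D_w η)(v)`. -/
def extDerivOneForm (η : OneForm E M) (p : M) (v w : TangentSpace 𝓘(ℝ, E) p) : ℝ :=
  let c : E := extChartAt 𝓘(ℝ, E) p p
  let v' : E := mfderiv 𝓘(ℝ, E) 𝓘(ℝ, E) (extChartAt 𝓘(ℝ, E) p) p v
  let w' : E := mfderiv 𝓘(ℝ, E) 𝓘(ℝ, E) (extChartAt 𝓘(ℝ, E) p) p w
  fderiv ℝ (oneFormInChart η p) c v' w' - fderiv ℝ (oneFormInChart η p) c w' v'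

/-- A rank `m` distribution `D ⊆ TM` is of class `C^k` if near every point it is spanned by
`m` vector fields of class `C^k`. -/
def IsDistributionOfClass [IsManifold 𝓘(ℝ, E) ∞ M] (k : ℕ∞) (m : ℕ)
    (D : ∀ p : M, Submodule ℝ (TangentSpace 𝓘(ℝ, E) p)) : Prop :=
  ∀ p₀ : M, ∃ U : Set M, IsOpen U ∧ p₀ ∈ U ∧
    ∃ X : Fin m → ∀ p : M, TangentSpace 𝓘(ℝ, E) p,
      (∀ j, ContMDiffOn 𝓘(ℝ, E) 𝓘(ℝ, E).tangent k
        (fun p => (⟨p, X j p⟩ : TangentBundle 𝓘(ℝ, E) M)) U) ∧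
      ∀ p ∈ U, LinearIndependent ℝ (fun j => X j p) ∧
        Submodule.span ℝ (range fun j => X j p) = D p

/-- A `q`-contact structure with forms of class `C^k` on the `(2n+q)`-dimensional manifold `M`:
linearly independent `1`-forms `λ_1, …, λ_q` (the adapted coframe) and a splitting
`TM = R ⊕ ξ` with `ξ = ⋂ ker λ_i`, such that every `dλ_i` is nondegenerate on `ξ` and has
kernel `R`. The splitting is of class `C^1`. -/
structure QContactStructure (k : ℕ∞) (n q : ℕ)
    (E : Type*) [NormedAddCommGroup E] [NormedSpace ℝ E]
    (M : Type*) [TopologicalSpace M] [ChartedSpace E M] [IsManifold 𝓘(ℝ, E) ∞ M] where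
  n_pos : 0 < n
  q_pos : 0 < q
  finrank_eq : finrank ℝ E = 2 * n + q
  /-- the adapted coframe -/
  form : Fin q → OneForm E M
  /-- the Reeb distribution -/
  reeb : ∀ p : M, Submodule ℝ (TangentSpace 𝓘(ℝ, E) p)
  /-- the `q`-contact distribution -/
  xi : ∀ p : M, Submodule ℝ (TangentSpace 𝓘(ℝ, E) p)
  form_class : ∀ i, IsOneFormOfClass k (form i)
  reeb_class : IsDistributionOfClass 1 q reeb
  xi_class : IsDistributionOfClass 1 (2 * n) xi
  linearIndependent : ∀ p, LinearIndependent ℝ (fun i => form i p)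
  isCompl : ∀ p, IsCompl (reeb p) (xi p)
  mem_xi_iff : ∀ p v, v ∈ xi p ↔ ∀ i, form i p v = 0
  nondegenerate : ∀ i p, ∀ v ∈ xi p, (∀ w ∈ xi p, extDerivOneForm (form i) p v w = 0) → v = 0
  mem_reeb_iff : ∀ i p v, v ∈ reeb p ↔ ∀ w, extDerivOneForm (form i) p v w = 0

namespace QContactStructure

variable [IsManifold 𝓘(ℝ, E) ∞ M] {k : ℕ∞} {n q : ℕ}

/-- `p` and `p'` lie on the same leaf of the restriction to `U` of the contact foliation, the
foliation tangent to the Reeb distribution: they are joined by a `C^1` path in `U` which is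
everywhere tangent to the Reeb distribution. -/
def SameLeafIn (S : QContactStructure k n q E M) (U : Set M) (p p' : M) : Prop :=
  ∃ γ : ℝ → M, ContMDiffOn 𝓘(ℝ, ℝ) 𝓘(ℝ, E) 1 γ (Icc 0 1) ∧
    (∀ t ∈ Icc (0 : ℝ) 1, γ t ∈ U) ∧
    (∀ t ∈ Icc (0 : ℝ) 1,
      mfderivWithin 𝓘(ℝ, ℝ) 𝓘(ℝ, E) γ (Icc 0 1) t (1 : ℝ) ∈ S.reeb (γ t)) ∧
    γ 0 = p ∧ γ 1 = p'

/-- `f` is leafwise constant on `U`: it is constant on every leaf of the restriction to `U` of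
the contact foliation. -/
def LeafwiseConstantOn (S : QContactStructure k n q E M) (f : M → ℝ) (U : Set M) : Prop :=
  ∀ p p', S.SameLeafIn U p p' → f p = f p'

end QContactStructure

end ContactFoliation

end

/-! Let R_j be the sections of the Reeb distribution with λ_i(R_j) = δ_ij. Since R_j lies in ker
dλ_i, Cartan's formula shows that the time-one flow of ∑ t_j R_j, with t as a parameter, pulls λ_i
back to λ_i + dt_i (`exists_reeb_flow`). Flowing out of a flat 2-dimensional slice transverse to the
R_j gives coordinates (u, v, t) with λ_i = f_i(u,v) du + g_i(u,v) dv + dt_i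
(`exists_reeb_parametrization`). Integrating f_i in u gives W_i with f_i du + g_i dv = dW_i + a_i dv
and ∂_u a_i = c_i, where c_i = ∂_u g_i - ∂_v f_i (`exists_planar_normal_form`). Now dλ_i = c_i
du∧dv, and c_i never vanishes because ker dλ_i has rank q < q + 2. Put y = v, z_i = t_i + W_i and x
= a_1; then ∂_x a_i = c_i / c_1. The a_i depend only on (u, v), which is constant along the leaves
(`exists_local_normal_form`).

The remaining work is to lose no derivatives. The R_j are of class C^{max(r,1)}: for r ≥ 1 they
solve a linear system with C^r coefficients, and for r = 0 the C^1 splitting is used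
(`exists_reeb_fields`). The flow has the same class, while f_i and g_i are still C^{r+1}, being read
off on an affine slice. As the flow may be only C^1, dλ_i = c_i du∧dv needs d to commute with C^1
pullbacks (`fderiv_skew_of_eventuallyEq_pullback`). For r = 0 the function a_1 is only known to be
continuous with continuous ∂_u a_1, so the inverse function theorem gives way to an intermediate
value argument (`exists_openPartialHomeomorph_graph`).

Smooth dependence of flows comes from inverting γ ↦ γ - ∫ V(γ) on the Banach space of curves
(`exists_contDiff_flow`), where composition with V is a smooth operator (`contDiff_postcomp`). -/

namespace ContactFoliation

/-! ### Exterior derivative and pullback by C^1 maps -/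

open Filter Topology Asymptotics in
/-- The exterior derivative of a `1`-form commutes with pullback by a map which is only `C^1`,
as soon as the pulled back form is differentiable. -/
theorem fderiv_skew_of_eventuallyEq_pullback {E F : Type*} [NormedAddCommGroup E] [NormedSpace ℝ E]
    [NormedAddCommGroup F] [NormedSpace ℝ F] {η : F → F →L[ℝ] ℝ} {μ : E → E →L[ℝ] ℝ} {φ : E → F}
    {x : E} (hφ : ContDiffAt ℝ 1 φ x) (hη : DifferentiableAt ℝ η (φ x))
    (hμ : DifferentiableAt ℝ μ x) (h : ∀ᶠ y in 𝓝 x, μ y = (η (φ y)).comp (fderiv ℝ φ y))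
    (v w : E) :
    fderiv ℝ μ x v w - fderiv ℝ μ x w v =
      fderiv ℝ η (φ x) (fderiv ℝ φ x v) (fderiv ℝ φ x w) -
        fderiv ℝ η (φ x) (fderiv ℝ φ x w) (fderiv ℝ φ x v) := by
  set A := fderiv ℝ φ x with hA
  set B := fderiv ℝ η (φ x) with hB
  have hφd : ∀ᶠ y in 𝓝 x, DifferentiableAt ℝ φ y :=
    (hφ.eventually (by simp)).mono fun y hy => hy.differentiableAt (by simp)
  have hφc : ContinuousAt (fderiv ℝ φ) x := hφ.continuousAt_fderiv (by simp)
  have hφx : HasFDerivAt φ A x := hφd.self_of_nhds.hasFDerivAt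
  have hBA (y : E) : HasFDerivAt (fun y => B (A (y - x))) (B.comp A) y :=
    (B.comp A).hasFDerivAt.comp y ((hasFDerivAt_id y).sub_const x)
  -- The remainder of the first-order expansion of η ∘ φ at x; it vanishes to first order there.
  let R : E → F →L[ℝ] ℝ := fun y => η (φ y) - η (φ x) - B (A (y - x))
  have hR : HasFDerivAt R (0 : E →L[ℝ] F →L[ℝ] ℝ) x := by
    have h1 : HasFDerivAt (fun y => η (φ y)) (B.comp A) x :=
      HasFDerivAt.comp x hη.hasFDerivAt hφx
    exact ((h1.sub_const (η (φ x))).fun_sub (hBA x)).congr_fderiv (sub_self _)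
  have hRx : R x = 0 := by simp [R]
  -- An o(y - x) factor times a bounded one: continuity of Dφ suffices and no second derivative of φ
  -- is taken.
  have hRD : HasFDerivAt (fun y => (R y).comp (fderiv ℝ φ y)) (0 : E →L[ℝ] E →L[ℝ] ℝ) x := by
    rw [hasFDerivAt_iff_isLittleO] at hR ⊢
    simp only [hRx, ContinuousLinearMap.zero_comp, sub_zero,
      zero_apply] at hR ⊢
    have hO : (fun y => fderiv ℝ φ y) =O[𝓝 x] fun _ => (1 : ℝ) := hφc.isBigO_one ℝ
    have := hR.norm_norm.mul_isBigO hO.norm_left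
    refine (IsBigO.of_norm_le fun y => ?_).trans_isLittleO (this.trans_isBigO ?_)
    · exact (R y).opNorm_comp_le _
    · simpa using (isBigO_refl (fun y => y - x) (𝓝 x)).norm_left
  -- Replacing η by its linearization at φ x makes the pullback an exact differential up to terms
  -- that are differentiable at x. Symmetry of the second derivative of g is then the claim.
  let g : E → ℝ := fun y => η (φ x) (φ y) + B (A (y - x)) (φ y - φ x)
  let g' : E → E →L[ℝ] ℝ := fun y =>
    (μ y - (R y).comp (fderiv ℝ φ y)) + (B.comp A).flip (φ y - φ x)
  have hg : ∀ᶠ y in 𝓝 x, HasFDerivAt g (g' y) y := by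
    filter_upwards [h, hφd] with y hy hyd
    have h1 : HasFDerivAt (fun y => η (φ x) (φ y)) ((η (φ x)).comp (fderiv ℝ φ y)) y :=
      (η (φ x)).hasFDerivAt.comp y hyd.hasFDerivAt
    have h3 := (hBA y).clm_apply (hyd.hasFDerivAt.sub_const (φ x))
    refine (h1.add h3).congr_fderiv ?_
    ext v
    simp only [g', R, hy, add_apply, ContinuousLinearMap.comp_apply, sub_apply]
    abel
  have hg' : HasFDerivAt g' (fderiv ℝ μ x + (B.comp A).flip.comp A) x := by
    have h4 : HasFDerivAt (fun y => (B.comp A).flip (φ y - φ x)) ((B.comp A).flip.comp A) x :=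
      ((B.comp A).flip.hasFDerivAt (x := φ x - φ x)).comp x (hφx.sub_const (φ x))
    exact ((hμ.hasFDerivAt.fun_sub hRD).fun_add h4).congr_fderiv (by rw [sub_zero])
  have := second_derivative_symmetric_of_eventually hg hg' v w
  simp only [add_apply, ContinuousLinearMap.comp_apply,
    ContinuousLinearMap.flip_apply] at this
  linarith

end ContactFoliation

/-! ### Composition operators on spaces of continuous maps -/

noncomputable section

namespace ContactFoliation

section Postcomp

universe u

variable {X : Type*} [TopologicalSpace X]

/-- Composition with a continuous map `V`, as a map between spaces of continuous functions on a
compact space. -/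
def postcomp {F G : Type*} [NormedAddCommGroup F] [NormedAddCommGroup G] {V : F → G}
    (hV : Continuous V) (γ : C(X, F)) : C(X, G) :=
  (⟨V, hV⟩ : C(F, G)).comp γ

@[simp]
theorem postcomp_apply {F G : Type*} [NormedAddCommGroup F] [NormedAddCommGroup G] {V : F → G}
    (hV : Continuous V) (γ : C(X, F)) (x : X) : postcomp hV γ x = V (γ x) := rfl

theorem continuous_postcomp {F G : Type*} [NormedAddCommGroup F] [NormedAddCommGroup G]
    {V : F → G} (hV : Continuous V) : Continuous (postcomp (X := X) hV) :=
  ContinuousMap.continuous_postcomp _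

variable [CompactSpace X]

/-- The pointwise application of a continuous bilinear map to two continuous maps. -/
def pointwiseBilinear {H F G : Type*} [NormedAddCommGroup H] [NormedSpace ℝ H]
    [NormedAddCommGroup F] [NormedSpace ℝ F] [NormedAddCommGroup G] [NormedSpace ℝ G]
    (B : H →L[ℝ] F →L[ℝ] G) : C(X, H) →L[ℝ] C(X, F) →L[ℝ] C(X, G) :=
  LinearMap.mkContinuous₂
    (LinearMap.mk₂ ℝ (fun (A : C(X, H)) (f : C(X, F)) =>
        (⟨fun x => B (A x) (f x), (B.continuous.comp A.continuous).clm_apply f.continuous⟩ :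
          C(X, G)))
      (by intros; ext; simp) (by intros; ext; simp) (by intros; ext; simp) (by intros; ext; simp))
    ‖B‖
    (fun A f => by
      rw [ContinuousMap.norm_le _ (by positivity)]
      intro x
      simpa using (B (A x)).le_of_opNorm_le_of_le
        (B.le_of_opNorm_le_of_le le_rfl (A.norm_coe_le_norm x)) (f.norm_coe_le_norm x))

theorem contDiff_pointwiseBilinear {H F G : Type*} [NormedAddCommGroup H] [NormedSpace ℝ H]
    [NormedAddCommGroup F] [NormedSpace ℝ F] [NormedAddCommGroup G] [NormedSpace ℝ G]
    (B : H →L[ℝ] F →L[ℝ] G) {n : WithTop ℕ∞} :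
    ContDiff ℝ n (fun A : C(X, H) => pointwiseBilinear B A) :=
  (pointwiseBilinear (X := X) B).contDiff

variable {F G : Type*} [NormedAddCommGroup F] [NormedSpace ℝ F] [NormedAddCommGroup G]
  [NormedSpace ℝ G]

/-- Pointwise application of a continuous family of continuous linear maps. -/
abbrev pointwiseApply {X : Type*} [TopologicalSpace X] [CompactSpace X] (F G : Type*)
    [NormedAddCommGroup F] [NormedSpace ℝ F]
    [NormedAddCommGroup G] [NormedSpace ℝ G] :=
  pointwiseBilinear (X := X) (H := F →L[ℝ] G) (F := F) (G := G) (ContinuousLinearMap.id ℝ (F →L[ℝ] G))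

/-- The mean value inequality at each x, with an estimate on DV that is uniform in x because γ ↦ DV
∘ γ is continuous in the sup norm. -/
theorem hasFDerivAt_postcomp {V : F → G} (hV : ContDiff ℝ 1 V) (γ : C(X, F)) :
    HasFDerivAt (postcomp hV.continuous)
      (pointwiseApply F G (postcomp (hV.continuous_fderiv (by simp)) γ)) γ := by
  rcases isEmpty_or_nonempty X with hX | hX
  · exact (hasFDerivAt_const (0 : C(X, G)) γ).congr_fderiv (by ext _ x; exact hX.elim x)
      |>.congr_of_eventuallyEq (.of_forall fun _ => by ext x; exact hX.elim x)
  rw [hasFDerivAt_iff_isLittleO, Asymptotics.isLittleO_iff]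
  intro c hc
  obtain ⟨δ, hδ, hball⟩ := Metric.continuousAt_iff.1
    ((continuous_postcomp (X := X) (hV.continuous_fderiv (by simp))).continuousAt (x := γ)) c hc
  filter_upwards [Metric.ball_mem_nhds γ hδ] with γ' hγ'
  rw [ContinuousMap.norm_le _ (by positivity)]
  intro x
  have hx : γ' x ∈ Metric.ball (γ x) δ := (ContinuousMap.dist_apply_le_dist x).trans_lt hγ'
  have key := (convex_ball (γ x) δ).norm_image_sub_le_of_norm_hasFDerivWithin_le' (f := V)
    (f' := fderiv ℝ V) (φ := fderiv ℝ V (γ x)) (C := c) (x := γ x) (y := γ' x)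
    (fun z _ => ((hV.differentiable (by simp)) z).hasFDerivAt.hasFDerivWithinAt)
    (fun z hz => by
      -- Translating γ by a constant so that it passes through z at x turns sup-norm continuity into
      -- a bound on DV z - DV (γ x).
      have h1 : dist (γ + ContinuousMap.const X (z - γ x)) γ < δ := by
        rw [dist_eq_norm, add_sub_cancel_left]
        refine lt_of_le_of_lt ?_ (mem_ball_iff_norm.1 hz)
        exact (ContinuousMap.norm_le _ (norm_nonneg _)).2 fun _ => le_rfl
      have h2 := (ContinuousMap.dist_apply_le_dist x).trans_lt (hball h1)
      rw [dist_eq_norm] at h2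
      simpa using h2.le)
    (Metric.mem_ball_self hδ) hx
  refine key.trans (mul_le_mul_of_nonneg_left ?_ hc.le)
  exact (γ' - γ).norm_coe_le_norm x

/-- The derivative is again a composition operator, with DV, followed by a continuous linear map;
hence the induction. F and G share a universe so that G can be replaced by `F →L[ℝ] G`. -/
theorem contDiff_postcomp_nat (m : ℕ) {F G : Type u} [NormedAddCommGroup F] [NormedSpace ℝ F]
    [NormedAddCommGroup G] [NormedSpace ℝ G] {V : F → G} (hV : ContDiff ℝ m V) :
    ContDiff ℝ m (postcomp (X := X) hV.continuous) := by
  induction m generalizing G with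
  | zero => exact contDiff_zero.2 (continuous_postcomp _)
  | succ m ih =>
    have h1 : ContDiff ℝ 1 V := hV.of_le (by norm_cast; omega)
    have hD : ContDiff ℝ m (fderiv ℝ V) := hV.fderiv_right (by norm_cast)
    push_cast
    rw [contDiff_succ_iff_hasFDerivAt]
    exact ⟨fun γ => pointwiseApply F G (postcomp hD.continuous γ),
      (contDiff_pointwiseBilinear _).comp (ih hD), hasFDerivAt_postcomp h1⟩

theorem contDiff_postcomp {m : ℕ∞} {F G : Type u} [NormedAddCommGroup F] [NormedSpace ℝ F]
    [NormedAddCommGroup G] [NormedSpace ℝ G] {V : F → G} (hV : ContDiff ℝ m V) :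
    ContDiff ℝ m (postcomp (X := X) hV.continuous) := by
  rw [contDiff_iff_forall_nat_le]
  intro k hk
  exact contDiff_postcomp_nat k (hV.of_le (by exact_mod_cast hk))

end Postcomp

end ContactFoliation

end

/-! ### Smooth dependence of flows on the initial point -/

noncomputable section

namespace ContactFoliation

section Flow

open scoped unitInterval

theorem continuous_IccExtend_unitInterval {F : Type*} [TopologicalSpace F] (γ : C(I, F)) :
    Continuous (IccExtend zero_le_one γ) :=
  γ.continuous.Icc_extend'

variable {F : Type*} [NormedAddCommGroup F] [NormedSpace ℝ F]

/-- Integration from `0`, as an operator on the space of continuous curves on `[0, 1]`. -/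
def integration (F : Type*) [NormedAddCommGroup F] [NormedSpace ℝ F] : C(I, F) →L[ℝ] C(I, F) :=
  LinearMap.mkContinuous
    { toFun := fun γ =>
        ⟨fun s => ∫ τ in (0 : ℝ)..s, IccExtend zero_le_one γ τ,
          (intervalIntegral.continuous_primitive
            (fun a b => (continuous_IccExtend_unitInterval γ).intervalIntegrable a b) 0).comp
            continuous_subtype_val⟩
      map_add' := fun γ γ' => by
        ext s
        exact intervalIntegral.integral_add
          ((continuous_IccExtend_unitInterval γ).intervalIntegrable _ _)
          ((continuous_IccExtend_unitInterval γ').intervalIntegrable _ _)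
      map_smul' := fun c γ => by
        ext s
        exact intervalIntegral.integral_smul c (IccExtend zero_le_one γ) }
    1
    (fun γ => by
      rw [ContinuousMap.norm_le _ (by positivity)]
      intro s
      have := intervalIntegral.norm_integral_le_of_norm_le_const (a := (0 : ℝ)) (b := s)
        (f := IccExtend zero_le_one γ) (C := ‖γ‖) (fun τ _ => γ.norm_coe_le_norm _)
      refine this.trans ?_
      rw [sub_zero, abs_of_nonneg s.2.1, one_mul]
      exact mul_le_of_le_one_right (norm_nonneg _) s.2.2)

theorem integration_apply (γ : C(I, F)) (s : I) :
    integration F γ s = ∫ τ in (0 : ℝ)..s, IccExtend zero_le_one γ τ := rfl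

theorem norm_integration_le : ‖integration F‖ ≤ 1 :=
  LinearMap.mkContinuous_norm_le _ zero_le_one _

variable [CompleteSpace F]

/-- The fundamental theorem of calculus turns the integral equation into an initial value problem.
It serves both the flow and its linearization. -/
theorem hasDerivWithinAt_of_sub_integration_eq_const {δ κ : C(I, F)} {x : F}
    (h : δ - integration F κ = ContinuousMap.const I x) :
    δ 0 = x ∧ ∀ s : I, HasDerivWithinAt (IccExtend zero_le_one δ) (κ s) (Icc 0 1) s := by
  have h' (s : I) : δ s = x + ∫ τ in (0 : ℝ)..s, IccExtend zero_le_one κ τ := by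
    have := congrArg (fun f : C(I, F) => f s) h
    simp only [ContinuousMap.sub_apply, ContinuousMap.const_apply, integration_apply] at this
    rw [← this]
    abel
  refine ⟨by simpa using h' 0, fun s => ?_⟩
  have hκ := continuous_IccExtend_unitInterval κ
  have h1 : HasDerivAt (fun t : ℝ => x + ∫ τ in (0 : ℝ)..t, IccExtend zero_le_one κ τ) (κ s)
      (s : ℝ) := by
    have := intervalIntegral.integral_hasDerivAt_right (hκ.intervalIntegrable 0 (s : ℝ))
      hκ.stronglyMeasurable.stronglyMeasurableAtFilter hκ.continuousAt
    simpa using this.const_add x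
  refine h1.hasDerivWithinAt.congr (fun t ht => ?_) ?_
  · rw [IccExtend_of_mem _ _ ht]
    exact h' ⟨t, ht⟩
  · rw [IccExtend_val]
    exact h' s

/-- The time-`[0, 1]` flow of a vector field of class `C^m` whose derivative is bounded by `1/2`
depends in a `C^m` way on the initial point, and its derivative solves the linearized equation. -/
theorem exists_contDiff_flow {m : ℕ∞} (hm : 1 ≤ m) {V : F → F} (hV : ContDiff ℝ m V)
    (hbound : ∀ x, ‖fderiv ℝ V x‖ ≤ 1 / 2) :
    ∃ Γ : F → C(I, F), ContDiff ℝ m Γ ∧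
      (∀ x, Γ x 0 = x ∧
        ∀ s : I, HasDerivWithinAt (IccExtend zero_le_one (Γ x)) (V (Γ x s)) (Icc 0 1) s) ∧
      (∀ x w, fderiv ℝ Γ x w 0 = w ∧
        ∀ s : I, HasDerivWithinAt (IccExtend zero_le_one (fderiv ℝ Γ x w))
          (fderiv ℝ V (Γ x s) (fderiv ℝ Γ x w s)) (Icc 0 1) s) ∧
      (∀ x, V x = 0 → Γ x = ContinuousMap.const I x) := by
  have hV1 : ContDiff ℝ 1 V := hV.of_le (by exact_mod_cast hm)
  let T : C(I, F) → C(I, F) →L[ℝ] C(I, F) := fun γ => (integration F).comp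
    (pointwiseApply F F (postcomp (hV1.continuous_fderiv (by simp)) γ))
  have hT (γ : C(I, F)) : ‖T γ‖ ≤ 1 / 2 := by
    refine ContinuousLinearMap.opNorm_le_bound _ (by norm_num) fun δ => ?_
    refine ((integration F).le_of_opNorm_le norm_integration_le _).trans ?_
    rw [one_mul, ContinuousMap.norm_le _ (by positivity)]
    intro s
    exact (fderiv ℝ V (γ s)).le_of_opNorm_le_of_le (hbound _) (δ.norm_coe_le_norm s)
  -- The equation Q γ = const x is the integral form of γ' = V(γ), γ(0) = x, so the flow is the
  -- inverse of Q on constants.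
  let Q : C(I, F) → C(I, F) := fun γ => γ - integration F (postcomp hV1.continuous γ)
  have hQ : ContDiff ℝ m Q :=
    contDiff_id.sub ((integration F).contDiff.comp (contDiff_postcomp hV))
  have hT' (γ : C(I, F)) : HasFDerivAt (fun γ => integration F (postcomp hV1.continuous γ))
      (T γ) γ :=
    (integration F).hasFDerivAt.comp γ (hasFDerivAt_postcomp hV1 γ)
  have hQ' (γ : C(I, F)) : HasFDerivAt Q (ContinuousLinearMap.id ℝ _ - T γ) γ :=
    (hasFDerivAt_id γ).sub (hT' γ)
  have happrox : ApproximatesLinearOn Q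
      ((ContinuousLinearEquiv.refl ℝ C(I, F) : C(I, F) ≃L[ℝ] C(I, F)) :
        C(I, F) →L[ℝ] C(I, F)) univ (1 / 2 : NNReal) := by
    intro γ _ γ' _
    have := convex_univ.norm_image_sub_le_of_norm_hasFDerivWithin_le
      (f := fun γ => integration F (postcomp hV1.continuous γ)) (C := 1 / 2)
      (fun γ _ => (hT' γ).hasFDerivWithinAt) (fun γ _ => hT γ) (mem_univ γ') (mem_univ γ)
    have h : Q γ - Q γ' - (γ - γ') = -(integration F (postcomp hV1.continuous γ) -
        integration F (postcomp hV1.continuous γ')) := by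
      simp only [Q]
      abel
    change ‖Q γ - Q γ' - (γ - γ')‖ ≤ _
    rw [h, norm_neg]
    simpa using this
  -- Q differs from the identity by a 1/2-Lipschitz map, hence is a global homeomorphism.
  let e : C(I, F) ≃ₜ C(I, F) := happrox.toHomeomorph Q (by
    rcases subsingleton_or_nontrivial C(I, F) with h | h
    · exact Or.inl h
    · refine Or.inr ?_
      have : ‖((ContinuousLinearEquiv.refl ℝ C(I, F)).symm : C(I, F) →L[ℝ] C(I, F))‖₊ = 1 := by
        ext
        simp
      rw [this]
      norm_num)
  have hequiv (γ : C(I, F)) : ∃ L : C(I, F) ≃L[ℝ] C(I, F),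
      (L : C(I, F) →L[ℝ] C(I, F)) = ContinuousLinearMap.id ℝ _ - T γ :=
    ⟨ContinuousLinearEquiv.unitsEquiv ℝ _
      (Units.oneSub (T γ) ((hT γ).trans_lt (by norm_num))), rfl⟩
  choose L hL using hequiv
  have he : ContDiff ℝ m e.symm :=
    e.contDiff_symm (f₀' := L) (fun γ => by rw [hL]; exact hQ' γ) hQ
  let c : F →L[ℝ] C(I, F) := LinearMap.mkContinuous
    { toFun := fun x => ContinuousMap.const I x
      map_add' := fun _ _ => rfl
      map_smul' := fun _ _ => rfl } 1
    (fun x => by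
      rw [one_mul]
      exact (ContinuousMap.norm_le _ (norm_nonneg _)).2 fun _ => le_rfl)
  have hΓ : ContDiff ℝ m (fun x => e.symm (c x)) := he.comp c.contDiff
  have hQΓ (x : F) : Q (e.symm (c x)) = c x := e.apply_symm_apply (c x)
  refine ⟨fun x => e.symm (c x), hΓ, fun x =>
    hasDerivWithinAt_of_sub_integration_eq_const (hQΓ x), fun x w => ?_, fun x hx => ?_⟩
  swap
  · refine (e.symm_apply_eq).2 ?_
    have h0 : postcomp hV1.continuous (ContinuousMap.const I x) = 0 := by
      ext s
      simpa using hx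
    change _ = Q (ContinuousMap.const I x)
    simp only [Q, h0, map_zero, sub_zero]
    rfl
  refine hasDerivWithinAt_of_sub_integration_eq_const
    (κ := pointwiseApply F F (postcomp (hV1.continuous_fderiv (by simp)) (e.symm (c x)))
      (fderiv ℝ (fun x => e.symm (c x)) x w)) ?_
  -- Differentiating Q(Γ x) = const x gives the linearized integral equation.
  have hd : DifferentiableAt ℝ (fun x => e.symm (c x)) x :=
    hΓ.differentiable (by exact_mod_cast (zero_lt_one.trans_le hm).ne') x
  have h1 := (hQ' (e.symm (c x))).comp x hd.hasFDerivAt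
  have h2 : HasFDerivAt (Q ∘ fun x => e.symm (c x)) c x := by
    have : (Q ∘ fun x => e.symm (c x)) = c := funext hQΓ
    rw [this]
    exact c.hasFDerivAt
  exact congrArg (fun A : F →L[ℝ] C(I, F) => A w) (h1.unique h2)

end Flow

end ContactFoliation

end

/-! ### The joint flow of the Reeb fields -/

noncomputable section

namespace ContactFoliation

open scoped unitInterval
open Filter Topology

theorem eq_add_smul_of_hasDerivWithinAt_const {G : Type*} [NormedAddCommGroup G] [NormedSpace ℝ G]
    {f : ℝ → G} {c : G} (h : ∀ s ∈ Icc (0 : ℝ) 1, HasDerivWithinAt f c (Icc 0 1) s) :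
    ∀ s ∈ Icc (0 : ℝ) 1, f s = f 0 + s • c := by
  intro s hs
  have hg (t : ℝ) (ht : t ∈ Icc (0 : ℝ) 1) :
      HasDerivWithinAt (fun t => f t - t • c) 0 (Icc 0 1) t := by
    simpa using (h t ht).fun_sub ((hasDerivWithinAt_id t (Icc 0 1)).smul_const c)
  have := constant_of_derivWithin_zero (f := fun t => f t - t • c)
    (fun t ht => (hg t ht).differentiableWithinAt)
    (fun t ht => (hg t ⟨ht.1, ht.2.le⟩).derivWithin
      (uniqueDiffOn_Icc zero_lt_one t ⟨ht.1, ht.2.le⟩)) s hs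
  simp only [zero_smul, sub_zero] at this
  rw [← this]
  abel

/-- A function of class `C^n` near a point of a finite-dimensional space agrees near that point
with a compactly supported function of class `C^n`. -/
theorem exists_contDiff_hasCompactSupport_eventuallyEq {E G : Type*} [NormedAddCommGroup E]
    [NormedSpace ℝ E] [FiniteDimensional ℝ E] [NormedAddCommGroup G] [NormedSpace ℝ G] {n : ℕ∞}
    {f : E → G} {O : Set E} (hO : IsOpen O) {x : E} (hx : x ∈ O) (hf : ContDiffOn ℝ n f O) :
    ∃ g : E → G, ContDiff ℝ n g ∧ HasCompactSupport g ∧ g =ᶠ[𝓝 x] f := by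
  obtain ⟨ε, hε, hball⟩ := Metric.isOpen_iff.1 hO x hx
  let b : ContDiffBump x := ⟨ε / 3, ε / 2, by positivity, by linarith⟩
  have hsub : tsupport b ⊆ O := by
    rw [b.tsupport_eq]
    exact (Metric.closedBall_subset_ball (by simp only [b]; linarith)).trans hball
  refine ⟨fun y => b y • f y, ?_, b.hasCompactSupport.smul_right, ?_⟩
  · rw [contDiff_iff_contDiffAt]
    intro y
    by_cases hy : y ∈ tsupport b
    · exact b.contDiff.contDiffAt.smul (hf.contDiffAt (hO.mem_nhds (hsub hy)))
    · refine contDiffAt_const (c := (0 : G)) |>.congr_of_eventuallyEq ?_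
      filter_upwards [notMem_tsupport_iff_eventuallyEq.1 hy] with z hz
      simp [hz]
  · filter_upwards [b.eventuallyEq_one] with y hy
    simp [hy]

theorem hasDerivWithinAt_fst {E G : Type*} [NormedAddCommGroup E] [NormedSpace ℝ E]
    [NormedAddCommGroup G] [NormedSpace ℝ G] {f : ℝ → E × G} {f' : E × G} {S : Set ℝ} {s : ℝ}
    (h : HasDerivWithinAt f f' S s) : HasDerivWithinAt (fun t => (f t).1) f'.1 S s :=
  (ContinuousLinearMap.fst ℝ E G).hasFDerivAt.comp_hasDerivWithinAt s h

theorem hasDerivWithinAt_snd {E G : Type*} [NormedAddCommGroup E] [NormedSpace ℝ E]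
    [NormedAddCommGroup G] [NormedSpace ℝ G] {f : ℝ → E × G} {f' : E × G} {S : Set ℝ} {s : ℝ}
    (h : HasDerivWithinAt f f' S s) : HasDerivWithinAt (fun t => (f t).2) f'.2 S s :=
  (ContinuousLinearMap.snd ℝ E G).hasFDerivAt.comp_hasDerivWithinAt s h

/-- Cartan's formula for the Lie derivative of a `1`-form along a field `f` in the kernel of its
exterior derivative, applied to a solution `ψ` of the linearized equation. -/
theorem hasDerivWithinAt_form_of_linearized {E : Type*} [NormedAddCommGroup E] [NormedSpace ℝ E]
    {q : ℕ} {η : E → E →L[ℝ] ℝ} {f : E × (Fin q → ℝ) → E} {y w : E × (Fin q → ℝ)} {i : Fin q}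
    {ε : ℝ} {x ψ : ℝ → E} {S : Set ℝ} {s : ℝ} (hx : HasDerivWithinAt x (ε • f y) S s)
    (hxs : x s = y.1) (hψ : HasDerivWithinAt ψ (ε • fderiv ℝ f y w) S s) (hψs : ψ s = w.1)
    (hη : DifferentiableAt ℝ η y.1) (hf : DifferentiableAt ℝ f y)
    (hηf : (fun y => η y.1 (f y)) =ᶠ[𝓝 y] fun y => y.2 i)
    (hker : fderiv ℝ η y.1 (f y) w.1 = fderiv ℝ η y.1 w.1 (f y)) :
    HasDerivWithinAt (fun s => η (x s) (ψ s)) (ε * w.2 i) S s := by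
  have h3 : HasFDerivAt η (fderiv ℝ η y.1) (x s) := by
    rw [hxs]
    exact hη.hasFDerivAt
  have h4 := (h3.comp_hasDerivWithinAt s hx).clm_apply hψ
  refine h4.congr_deriv ?_
  have h5 : HasFDerivAt (fun y : E × (Fin q → ℝ) => η y.1 (f y))
      ((η y.1).comp (fderiv ℝ f y) + ((fderiv ℝ η y.1).comp
        (ContinuousLinearMap.fst ℝ E (Fin q → ℝ))).flip (f y)) y :=
    (hη.hasFDerivAt.comp y hasFDerivAt_fst).clm_apply hf.hasFDerivAt
  have h7 : HasFDerivAt (fun y : E × (Fin q → ℝ) => y.2 i)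
      ((ContinuousLinearMap.proj (R := ℝ) (φ := fun _ : Fin q => ℝ) i).comp
        (ContinuousLinearMap.snd ℝ E (Fin q → ℝ))) y :=
    ((ContinuousLinearMap.proj (R := ℝ) (φ := fun _ : Fin q => ℝ) i).comp
      (ContinuousLinearMap.snd ℝ E (Fin q → ℝ))).hasFDerivAt
  have h8 := congrArg (fun A => A w) ((h5.congr_of_eventuallyEq hηf.symm).unique h7)
  simp only [add_apply, ContinuousLinearMap.comp_apply, ContinuousLinearMap.flip_apply,
    ContinuousLinearMap.coe_fst', ContinuousLinearMap.coe_snd',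
    ContinuousLinearMap.proj_apply] at h8
  simp only [Function.comp_apply, hxs, hψs, map_smul, smul_apply, smul_eq_mul, hker, ← h8]
  ring

/-- The joint flow of the Reeb fields pulls `λ_i` back to `λ_i + dt_i`. -/
theorem exists_reeb_flow {E : Type*} [NormedAddCommGroup E] [NormedSpace ℝ E]
    [FiniteDimensional ℝ E] {q : ℕ} {m : ℕ∞} (hm : 1 ≤ m) {O : Set E} (hO : IsOpen O) {x₀ : E}
    (hx₀ : x₀ ∈ O) {η : Fin q → E → E →L[ℝ] ℝ} {R : Fin q → E → E}
    (hη : ∀ i, ∀ x ∈ O, DifferentiableAt ℝ (η i) x) (hR : ∀ j, ContDiffOn ℝ m (R j) O)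
    (hηR : ∀ i j, ∀ x ∈ O, η i x (R j x) = if i = j then 1 else 0)
    (hker : ∀ i j, ∀ x ∈ O, ∀ w,
      fderiv ℝ (η i) x (R j x) w - fderiv ℝ (η i) x w (R j x) = 0) :
    ∃ Ψ : E × (Fin q → ℝ) → E, ContDiff ℝ m Ψ ∧ Ψ (x₀, 0) = x₀ ∧
      (∀ w, fderiv ℝ Ψ (x₀, 0) w = w.1 + ∑ j, w.2 j • R j x₀) ∧
      ∀ᶠ p in 𝓝 (x₀, 0), Ψ p ∈ O ∧ p.1 ∈ O ∧
        ∀ i w, η i (Ψ p) (fderiv ℝ Ψ p w) = η i p.1 w.1 + w.2 i := by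
  have : CompleteSpace E := FiniteDimensional.complete ℝ E
  -- The parameters t are carried as frozen coordinates, so a single flow is differentiated in x and
  -- t at once and no commutation of the R_j is needed.
  let f : E × (Fin q → ℝ) → E := fun p => ∑ j, p.2 j • R j p.1
  have hf : ContDiffOn ℝ m f (Prod.fst ⁻¹' O) := by
    refine ContDiffOn.sum fun j _ => ContDiffOn.smul ?_ ?_
    · exact ((contDiff_apply ℝ ℝ j).comp contDiff_snd).contDiffOn
    · exact (hR j).comp contDiff_fst.contDiffOn fun _ h => h
  have hO' : IsOpen (Prod.fst ⁻¹' O : Set (E × (Fin q → ℝ))) := hO.preimage continuous_fst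
  have hmne : ((m : ℕ∞) : WithTop ℕ∞) ≠ 0 := by
    exact_mod_cast (zero_lt_one.trans_le hm).ne'
  have hfd {y : E × (Fin q → ℝ)} (hy : y.1 ∈ O) : HasFDerivAt f (fderiv ℝ f y) y :=
    ((hf.contDiffAt (hO'.mem_nhds hy)).differentiableAt hmne).hasFDerivAt
  obtain ⟨g, hg, hgc, hgf⟩ := exists_contDiff_hasCompactSupport_eventuallyEq hO'
    (x := (x₀, (0 : Fin q → ℝ))) hx₀ hf
  obtain ⟨W, hWsub, hW, hxW⟩ := mem_nhds_iff.1 (inter_mem hgf (hO'.mem_nhds hx₀))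
  have hgfW {y : E × (Fin q → ℝ)} (hy : y ∈ W) : fderiv ℝ g y = fderiv ℝ f y :=
    Filter.EventuallyEq.fderiv_eq (mem_of_superset (hW.mem_nhds hy) fun z hz => (hWsub hz).1)
  obtain ⟨K, hK⟩ := (hgc.fderiv ℝ).exists_bound_of_continuous
    (hg.continuous_fderiv hmne)
  have hK0 : 0 ≤ K := (norm_nonneg _).trans (hK 0)
  -- Slowing time by ε brings the derivative bound K below 1/2; K + 1 avoids division by zero.
  let ε : ℝ := 1 / (2 * (K + 1))
  have hε : 0 < ε := by positivity
  let V : E × (Fin q → ℝ) → E × (Fin q → ℝ) := fun p => (ε • g p, 0)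
  have hV : ContDiff ℝ m V := (hg.const_smul ε).prodMk contDiff_const
  have hV' (p w) : fderiv ℝ V p w = (ε • fderiv ℝ g p w, 0) := by
    have h1 : HasFDerivAt V ((ε • fderiv ℝ g p).prod 0) p :=
      (((hg.differentiable hmne p).hasFDerivAt).const_smul ε).prodMk (hasFDerivAt_const 0 p)
    rw [h1.fderiv]
    rfl
  have hVb (p) : ‖fderiv ℝ V p‖ ≤ 1 / 2 := by
    refine ContinuousLinearMap.opNorm_le_bound _ (by norm_num) fun w => ?_
    rw [hV', Prod.norm_mk, norm_zero, max_eq_left (norm_nonneg _), norm_smul, Real.norm_eq_abs,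
      abs_of_pos hε]
    calc ε * ‖fderiv ℝ g p w‖ ≤ ε * (K * ‖w‖) := by
          gcongr
          exact (fderiv ℝ g p).le_of_opNorm_le (hK p) w
      _ ≤ 1 / 2 * ‖w‖ := by
          rw [← mul_assoc]
          gcongr
          simp only [ε]
          rw [div_mul_eq_mul_div, div_le_div_iff₀ (by positivity) (by norm_num)]
          linarith
  obtain ⟨Γ, hΓ, hΓode, hΓvar, hΓconst⟩ := exists_contDiff_flow hm hV hVb
  have hΓ0 : Γ (x₀, 0) = ContinuousMap.const I (x₀, 0) := by
    refine hΓconst _ ?_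
    have : g (x₀, 0) = 0 := by
      rw [hgf.self_of_nhds]
      simp [f]
    simp [V, this]
  have hΓW : ∀ᶠ p in 𝓝 (x₀, (0 : Fin q → ℝ)), ∀ s, Γ p s ∈ W := by
    obtain ⟨δ, hδ, hball⟩ := Metric.isOpen_iff.1 hW _ hxW
    have h1 : ∀ᶠ p in 𝓝 (x₀, (0 : Fin q → ℝ)), dist (Γ p) (Γ (x₀, 0)) < δ :=
      hΓ.continuous.continuousAt.eventually (Metric.ball_mem_nhds _ hδ)
    filter_upwards [h1] with p hp s
    apply hball
    have := (ContinuousMap.dist_apply_le_dist s).trans_lt hp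
    rwa [hΓ0] at this
  have hΓd (p) : HasFDerivAt Γ (fderiv ℝ Γ p) p := (hΓ.differentiable hmne p).hasFDerivAt
  have hsnd (p) (s : I) : (Γ p s).2 = p.2 := by
    have := eq_add_smul_of_hasDerivWithinAt_const
      (f := fun s => (IccExtend zero_le_one (Γ p) s).2) (c := 0)
      (fun s hs => hasDerivWithinAt_snd ((hΓode p).2 ⟨s, hs⟩)) s s.2
    simpa [(hΓode p).1] using this
  have hsnd' (p w) (s : I) : (fderiv ℝ Γ p w s).2 = w.2 := by
    have := eq_add_smul_of_hasDerivWithinAt_const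
      (f := fun s => (IccExtend zero_le_one (fderiv ℝ Γ p w) s).2) (c := 0)
      (fun s hs => by
        have := hasDerivWithinAt_snd ((hΓvar p w).2 ⟨s, hs⟩)
        rwa [hV'] at this) s s.2
    simpa [(hΓvar p w).1] using this
  -- Cartan's formula along the flow
  have hcartan {p} (hp : ∀ s, Γ p s ∈ W) (i w) :
      η i (Γ p 1).1 (fderiv ℝ Γ p w 1).1 = η i p.1 w.1 + ε * w.2 i := by
    have hder (s : I) : HasDerivWithinAt (fun s => η i (IccExtend zero_le_one (Γ p) s).1
        (IccExtend zero_le_one (fderiv ℝ Γ p w) s).1) (ε * w.2 i) (Icc 0 1) s := by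
      have hy := hp s
      have hyO : (Γ p s).1 ∈ O := (hWsub hy).2
      have h10 : g (Γ p s) = f (Γ p s) := (hWsub hy).1
      have h1 := hasDerivWithinAt_fst ((hΓode p).2 s)
      have h2 := hasDerivWithinAt_fst ((hΓvar p w).2 s)
      rw [hV', hgfW hy] at h2
      simp only [V, h10] at h1
      rw [← hsnd' p w s]
      refine hasDerivWithinAt_form_of_linearized h1 (by rw [IccExtend_val]) h2
        (by rw [IccExtend_val]) (hη i _ hyO) (hfd hyO).differentiableAt ?_ ?_
      · filter_upwards [hO'.mem_nhds hyO] with y hy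
        simp [f, map_sum, hηR i _ y.1 hy]
      · simp only [f, map_sum, map_smul, sum_apply, smul_apply]
        exact Finset.sum_congr rfl fun j _ => by
          rw [sub_eq_zero.1 (hker i j _ hyO (fderiv ℝ Γ p w s).1)]
    have := eq_add_smul_of_hasDerivWithinAt_const (fun s hs => hder ⟨s, hs⟩) 1
      (right_mem_Icc.2 zero_le_one)
    rw [IccExtend_right, IccExtend_left, IccExtend_right, IccExtend_left] at this
    simpa [(hΓode p).1, (hΓvar p w).1] using this
  -- Dividing t by ε undoes the slowed time.
  let L : E × (Fin q → ℝ) →L[ℝ] E × (Fin q → ℝ) :=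
    (ContinuousLinearMap.fst ℝ E (Fin q → ℝ)).prod (ε⁻¹ • ContinuousLinearMap.snd ℝ E (Fin q → ℝ))
  have hLapp (p) : L p = (p.1, ε⁻¹ • p.2) := rfl
  have hL0 : L (x₀, 0) = (x₀, 0) := by simp [hLapp]
  let e₁ : C(I, E × (Fin q → ℝ)) →L[ℝ] E :=
    (ContinuousLinearMap.fst ℝ E (Fin q → ℝ)).comp (ContinuousMap.evalCLM ℝ 1)
  have hΨ' (p w) : fderiv ℝ (fun p => (Γ (L p) 1).1) p w = (fderiv ℝ Γ (L p) (L w) 1).1 := by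
    have h1 : HasFDerivAt (fun p => (Γ (L p) 1).1) (e₁.comp ((fderiv ℝ Γ (L p)).comp L)) p :=
      e₁.hasFDerivAt.comp p ((hΓd (L p)).comp p L.hasFDerivAt)
    rw [h1.fderiv]
    rfl
  refine ⟨fun p => (Γ (L p) 1).1, e₁.contDiff.comp (hΓ.comp L.contDiff), ?_, ?_, ?_⟩
  · simp only [hL0, hΓ0]
    rfl
  · intro w
    rw [hΨ', hL0]
    have hder (s : I) := hasDerivWithinAt_fst ((hΓvar (x₀, 0) (L w)).2 s)
    -- The point (x₀, 0) is at rest, so the linearized equation along it has a constant right-hand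
    -- side.
    have h0 (y) : fderiv ℝ f (x₀, 0) y = ∑ j, y.2 j • R j x₀ := by
      have h1 : HasFDerivAt f (∑ j, ((0 : ℝ) • (fderiv ℝ (R j) x₀).comp
          (ContinuousLinearMap.fst ℝ E (Fin q → ℝ)) +
          ((ContinuousLinearMap.proj (R := ℝ) (φ := fun _ : Fin q => ℝ) j).comp
            (ContinuousLinearMap.snd ℝ E (Fin q → ℝ))).smulRight (R j x₀))) (x₀, 0) := by
        refine HasFDerivAt.fun_sum fun j _ => ?_
        have h2 : HasFDerivAt (fun p : E × (Fin q → ℝ) => R j p.1) ((fderiv ℝ (R j) x₀).comp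
            (ContinuousLinearMap.fst ℝ E (Fin q → ℝ))) (x₀, 0) :=
          HasFDerivAt.comp (x₀, (0 : Fin q → ℝ)) (((hR j).contDiffAt
            (hO.mem_nhds hx₀)).differentiableAt hmne).hasFDerivAt hasFDerivAt_fst
        exact (((ContinuousLinearMap.proj (R := ℝ) (φ := fun _ : Fin q => ℝ) j).comp
          (ContinuousLinearMap.snd ℝ E (Fin q → ℝ))).hasFDerivAt).smul h2
      rw [h1.fderiv]
      simp
    simp only [hV', hΓ0, ContinuousMap.const_apply, hgfW hxW, h0, hsnd'] at hder
    have := eq_add_smul_of_hasDerivWithinAt_const (fun s hs => hder ⟨s, hs⟩) 1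
      (right_mem_Icc.2 zero_le_one)
    rw [IccExtend_right, IccExtend_left] at this
    refine this.trans ?_
    change (fderiv ℝ Γ (x₀, 0) (L w) 0).1 + _ = _
    rw [(hΓvar _ _).1]
    simp [hLapp, Finset.smul_sum, smul_smul, hε.ne']
  · have hLt : Tendsto L (𝓝 (x₀, 0)) (𝓝 (x₀, 0)) := by
      simpa only [hL0] using L.continuous.tendsto (x₀, 0)
    filter_upwards [hLt.eventually hΓW] with p hp
    refine ⟨(hWsub (hp 1)).2, ?_, fun i w => ?_⟩
    · have := (hWsub (hp 0)).2
      rw [(hΓode _).1] at this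
      exact this
    · rw [hΨ', hcartan hp]
      simp [hLapp, hε.ne']

end ContactFoliation

end

/-! ### One-forms on the plane -/

noncomputable section

namespace ContactFoliation

open scoped unitInterval
open Filter Topology

/-- The primitive `∫₀ᵘ f(s, v) ds` of `f` in its first variable. -/
def fstPrimitive (f : ℝ × ℝ → ℝ) (p : ℝ × ℝ) : ℝ := ∫ s in (0 : ℝ)..p.1, f (s, p.2)

/-- The segment `s ↦ (s u, v)`, as a linear function of `(u, v)`. -/
def horizontalSegment : ℝ × ℝ →L[ℝ] C(I, ℝ × ℝ) :=
  LinearMap.mkContinuous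
    { toFun := fun p => ⟨fun s => ((s : ℝ) * p.1, p.2), by fun_prop⟩
      map_add' := fun p p' => by ext s <;> simp [mul_add]
      map_smul' := fun c p => by ext s <;> simp [mul_left_comm] } 1
    (fun p => by
      rw [one_mul, ContinuousMap.norm_le _ (norm_nonneg _)]
      intro s
      simp only [LinearMap.coe_mk, AddHom.coe_mk, ContinuousMap.coe_mk, Prod.norm_mk, norm_mul]
      refine max_le ?_ (norm_snd_le p)
      refine (mul_le_of_le_one_left (norm_nonneg _) ?_).trans (norm_fst_le p)
      rw [Real.norm_eq_abs, abs_of_nonneg s.2.1]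
      exact s.2.2)

theorem horizontalSegment_apply (p : ℝ × ℝ) (s : I) :
    horizontalSegment p s = ((s : ℝ) * p.1, p.2) := rfl

/-- Rescaling to the fixed interval [0, 1] makes the endpoint enter only through a linear family of
segments, so smoothness follows from that of composition operators. -/
theorem fstPrimitive_eq {f : ℝ × ℝ → ℝ} (p : ℝ × ℝ) {κ : C(I, ℝ)}
    (hκ : ∀ s : I, κ s = f (horizontalSegment p s)) :
    fstPrimitive f p = p.1 * integration ℝ κ 1 := by
  have h1 : integration ℝ κ 1 = ∫ s in (0 : ℝ)..1, f (s * p.1, p.2) := by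
    rw [integration_apply, Icc.coe_one]
    refine intervalIntegral.integral_congr fun s hs => ?_
    rw [uIcc_of_le zero_le_one] at hs
    simp only [IccExtend_of_mem _ _ hs, hκ, horizontalSegment_apply]
  rw [h1, ← smul_eq_mul, intervalIntegral.smul_integral_comp_mul_right (fun s => f (s, p.2))]
  simp [fstPrimitive]

theorem contDiff_fstPrimitive {m : ℕ∞} {f : ℝ × ℝ → ℝ} (hf : ContDiff ℝ m f) :
    ContDiff ℝ m (fstPrimitive f) := by
  have h : fstPrimitive f = fun p => p.1 * ((ContinuousMap.evalCLM ℝ (1 : I)).comp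
      (integration ℝ)) (postcomp hf.continuous (horizontalSegment p)) :=
    funext fun p => fstPrimitive_eq p fun s => rfl
  rw [h]
  exact contDiff_fst.mul (((ContinuousMap.evalCLM ℝ (1 : I)).comp (integration ℝ)).contDiff.comp
    ((contDiff_postcomp hf).comp horizontalSegment.contDiff))

theorem hasDerivAt_fstPrimitive_fst {f : ℝ × ℝ → ℝ} (hf : Continuous f) (u v : ℝ) :
    HasDerivAt (fun u => fstPrimitive f (u, v)) (f (u, v)) u := by
  have hc : Continuous fun s => f (s, v) := by fun_prop
  exact intervalIntegral.integral_hasDerivAt_right (hc.intervalIntegrable 0 u)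
    hc.stronglyMeasurable.stronglyMeasurableAtFilter hc.continuousAt

/-- The u-derivative is the fundamental theorem of calculus; the v-derivative is differentiation
under the integral, supplied by `hasFDerivAt_postcomp`. -/
theorem fderiv_fstPrimitive {f : ℝ × ℝ → ℝ} (hf : ContDiff ℝ 1 f) (p w : ℝ × ℝ) :
    fderiv ℝ (fstPrimitive f) p w =
      f p * w.1 + fstPrimitive (fun p => fderiv ℝ f p (0, 1)) p * w.2 := by
  have hd : DifferentiableAt ℝ (fstPrimitive f) p :=
    (contDiff_fstPrimitive (m := 1) hf).differentiable (by simp) p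
  have h1 : fderiv ℝ (fstPrimitive f) p (1, 0) = f p := by
    have := hd.hasFDerivAt.comp_hasDerivAt p.1
      ((hasDerivAt_id p.1).prodMk (hasDerivAt_const p.1 p.2))
    exact this.unique (hasDerivAt_fstPrimitive_fst hf.continuous p.1 p.2)
  have h2 : fderiv ℝ (fstPrimitive f) p (0, 1) =
      fstPrimitive (fun p => fderiv ℝ f p (0, 1)) p := by
    let A : C(I, ℝ) →L[ℝ] ℝ := (ContinuousMap.evalCLM ℝ (1 : I)).comp (integration ℝ)
    have h : fstPrimitive f = fun p => p.1 * A (postcomp hf.continuous (horizontalSegment p)) :=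
      funext fun p => fstPrimitive_eq p fun s => rfl
    have h5 := A.hasFDerivAt.comp p
      ((hasFDerivAt_postcomp hf _).comp p horizontalSegment.hasFDerivAt)
    have h6 : HasFDerivAt (fun p : ℝ × ℝ => p.1) (ContinuousLinearMap.fst ℝ ℝ ℝ) p :=
      hasFDerivAt_fst
    have h3 := h6.mul h5
    have h4 := h3.congr_of_eventuallyEq (Eventually.of_forall fun p => congrFun h p)
    rw [h4.fderiv, fstPrimitive_eq p (κ := pointwiseApply (ℝ × ℝ) ℝ
      (postcomp (hf.continuous_fderiv (by simp)) (horizontalSegment p))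
      (horizontalSegment (0, 1)))]
    · simp [A]
    · intro s
      simp [pointwiseBilinear, horizontalSegment_apply]
  have h3 : w = w.1 • ((1, 0) : ℝ × ℝ) + w.2 • ((0, 1) : ℝ × ℝ) := by
    ext <;> simp
  conv_lhs => rw [h3]
  rw [map_add, map_smul, map_smul, h1, h2, smul_eq_mul, smul_eq_mul]
  ring

/-- A `1`-form `f du + g dv` of class `C^{r+1}` on the plane is of the form `dW + a dv` with
`a` of class `C^r` and `∂_u a = ∂_u g - ∂_v f`. -/
theorem exists_planar_normal_form {r : ℕ∞} {f g : ℝ × ℝ → ℝ}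
    (hf : ContDiff ℝ (r + 1 : ℕ∞) f) (hg : ContDiff ℝ (r + 1 : ℕ∞) g) :
    ∃ W a : ℝ × ℝ → ℝ, ContDiff ℝ (r + 1 : ℕ∞) W ∧ ContDiff ℝ r a ∧
      (∀ p : ℝ × ℝ, HasDerivAt (fun u => a (u, p.2))
        (fderiv ℝ g p (1, 0) - fderiv ℝ f p (0, 1)) p.1) ∧
      ∀ p w : ℝ × ℝ, f p * w.1 + g p * w.2 = fderiv ℝ W p w + a p * w.2 := by
  have hle : ((1 : ℕ∞) : WithTop ℕ∞) ≤ (r + 1 : ℕ∞) := by exact_mod_cast le_add_self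
  have hf1 : ContDiff ℝ 1 f := hf.of_le hle
  have hg1 : ContDiff ℝ 1 g := hg.of_le hle
  have hfv : ContDiff ℝ r fun p => fderiv ℝ f p (0, 1) :=
    (hf.fderiv_right (by push_cast; exact le_rfl)).clm_apply contDiff_const
  refine ⟨fstPrimitive f, fun p => g p - fstPrimitive (fun p => fderiv ℝ f p (0, 1)) p,
    contDiff_fstPrimitive hf, ?_, fun p => ?_, fun p w => ?_⟩
  · exact (hg.of_le (by exact_mod_cast le_self_add)).sub (contDiff_fstPrimitive hfv)
  · refine HasDerivAt.fun_sub ?_ (hasDerivAt_fstPrimitive_fst hfv.continuous p.1 p.2)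
    exact (hg1.differentiable (by simp) p).hasFDerivAt.comp_hasDerivAt p.1
      ((hasDerivAt_id p.1).prodMk (hasDerivAt_const p.1 p.2))
  · rw [fderiv_fstPrimitive hf1]
    ring

end ContactFoliation

end

/-! ### Local inversion with one continuous partial derivative -/

noncomputable section

namespace ContactFoliation

open Filter Topology

section GraphMap

variable {P : Type*} [TopologicalSpace P] {α α' : ℝ × P → ℝ}

/-- Strict monotonicity in u gives α(u - ε, p) < α(u, p) < α(u + ε, p). These inequalities persist
for nearby values and parameters, and the intermediate value theorem supplies preimages. -/
theorem image_mem_nhds_of_hasDerivAt_fst (hα : Continuous α)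
    (hderiv : ∀ z : ℝ × P, HasDerivAt (fun u => α (u, z.2)) (α' z) z.1) {z : ℝ × P}
    (hz : ∀ᶠ y in 𝓝 z, 0 < α' y) {t : Set (ℝ × P)} (ht : t ∈ 𝓝 z) :
    (fun y => (α y, y.2)) '' t ∈ 𝓝 (α z, z.2) := by
  obtain ⟨u, p⟩ := z
  obtain ⟨T₁, hT₁, T₂, hT₂, hT⟩ := mem_nhds_prod_iff.1 (inter_mem ht hz)
  obtain ⟨ε, hε, hball⟩ := Metric.nhds_basis_closedBall.mem_iff.1 hT₁
  rw [Real.closedBall_eq_Icc] at hball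
  have hp : p ∈ T₂ := mem_of_mem_nhds hT₂
  have hmono : StrictMonoOn (fun s => α (s, p)) (Icc (u - ε) (u + ε)) := by
    refine strictMonoOn_of_deriv_pos (convex_Icc _ _) (by fun_prop) fun s hs => ?_
    rw [(hderiv (s, p)).deriv]
    exact (hT (mk_mem_prod (hball (interior_subset hs)) hp)).2
  have h1 : α (u - ε, p) < α (u, p) :=
    hmono ⟨le_rfl, by linarith⟩ ⟨by linarith, by linarith⟩ (by linarith)
  have h2 : α (u, p) < α (u + ε, p) :=
    hmono ⟨by linarith, by linarith⟩ ⟨by linarith, le_rfl⟩ (by linarith)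
  have h3 : ∀ᶠ y : ℝ × P in 𝓝 (α (u, p), p), α (u - ε, y.2) < y.1 :=
    ContinuousAt.eventually_lt (by fun_prop) (by fun_prop) h1
  have h4 : ∀ᶠ y : ℝ × P in 𝓝 (α (u, p), p), y.1 < α (u + ε, y.2) :=
    ContinuousAt.eventually_lt (by fun_prop) (by fun_prop) h2
  have h5 : ∀ᶠ y : ℝ × P in 𝓝 (α (u, p), p), y.2 ∈ T₂ :=
    continuous_snd.continuousAt.eventually hT₂
  filter_upwards [h3, h4, h5] with y hy1 hy2 hy3
  obtain ⟨s, hs, hsy⟩ := intermediate_value_Icc (f := fun s => α (s, y.2))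
    (by linarith : u - ε ≤ u + ε) (by fun_prop) ⟨hy1.le, hy2.le⟩
  exact ⟨(s, y.2), (hT (mk_mem_prod (hball hs) hy3)).1, Prod.ext hsy rfl⟩

theorem image_mem_nhds_of_hasDerivAt_fst_ne (hα : Continuous α) (hα' : Continuous α')
    (hderiv : ∀ z : ℝ × P, HasDerivAt (fun u => α (u, z.2)) (α' z) z.1) {z : ℝ × P}
    (hz : α' z ≠ 0) {t : Set (ℝ × P)} (ht : t ∈ 𝓝 z) :
    (fun y => (α y, y.2)) '' t ∈ 𝓝 (α z, z.2) := by
  rcases hz.lt_or_gt with hz | hz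
  · have h := image_mem_nhds_of_hasDerivAt_fst (α := fun y => -α y) (α' := fun y => -α' y)
      (by fun_prop) (fun y => (hderiv y).fun_neg) (z := z)
      ((hα'.continuousAt.eventually_lt continuousAt_const hz).mono fun y hy => neg_pos.2 hy) ht
    have hc : Continuous fun y : ℝ × P => (-y.1, y.2) := by fun_prop
    have := hc.continuousAt.preimage_mem_nhds (x := (α z, z.2)) h
    refine mem_of_superset this ?_
    rintro y ⟨x, hx, hxy⟩
    refine ⟨x, hx, ?_⟩
    simp only [Prod.mk.injEq, neg_inj] at hxy
    exact Prod.ext hxy.1 hxy.2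
  · exact image_mem_nhds_of_hasDerivAt_fst hα hderiv
      (continuousAt_const.eventually_lt hα'.continuousAt hz) ht

/-- If `α` and its partial derivative `α'` in the first variable are continuous and `α' ≠ 0`, then
`(u, p) ↦ (α (u, p), p)` is a local homeomorphism. -/
theorem exists_openPartialHomeomorph_graph {P : Type*} [NormedAddCommGroup P]
    {α α' : ℝ × P → ℝ} (hα : Continuous α) (hα' : Continuous α')
    (hderiv : ∀ z : ℝ × P, HasDerivAt (fun u => α (u, z.2)) (α' z) z.1) {z₀ : ℝ × P}
    (hz₀ : α' z₀ ≠ 0) :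
    ∃ h : OpenPartialHomeomorph (ℝ × P) (ℝ × P), z₀ ∈ h.source ∧
      (∀ z, h z = (α z, z.2)) ∧ (∀ z ∈ h.source, α' z ≠ 0) ∧
      (∀ y ∈ h.target, (h.symm y).2 = y.2) ∧
      ∀ y ∈ h.target, HasDerivAt (fun s => (h.symm (s, y.2)).1) (α' (h.symm y))⁻¹ y.1 := by
  obtain ⟨u₀, p₀⟩ := z₀
  obtain ⟨ε, hε, hball⟩ := Metric.isOpen_iff.1 (isOpen_ne_fun hα' continuous_const) _ hz₀
  rw [← ball_prod_same, Real.ball_eq_Ioo] at hball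
  have hinj : InjOn (fun z : ℝ × P => (α z, z.2))
      (Ioo (u₀ - ε) (u₀ + ε) ×ˢ Metric.ball p₀ ε) := by
    -- Rolle's theorem: equal values on one horizontal segment would produce a zero of α'.
    have key (u u' : ℝ) (p : P) (hu : u ∈ Ioo (u₀ - ε) (u₀ + ε)) (hu' : u' ∈ Ioo (u₀ - ε) (u₀ + ε))
        (hp : p ∈ Metric.ball p₀ ε) (h : α (u, p) = α (u', p)) : ¬ u < u' := by
      intro hlt
      obtain ⟨c, hc, hc0⟩ := exists_hasDerivAt_eq_zero (f := fun s => α (s, p))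
        (f' := fun s => α' (s, p)) hlt (by fun_prop) h (fun s _ => hderiv (s, p))
      exact hball (mk_mem_prod ⟨hu.1.trans hc.1, hc.2.trans hu'.2⟩ hp) hc0
    rintro ⟨u, p⟩ ⟨hu, hp⟩ ⟨u', p'⟩ ⟨hu', hp'⟩ h
    obtain ⟨h1, rfl⟩ := Prod.mk.inj h
    rcases lt_trichotomy u u' with hlt | rfl | hlt
    · exact (key u u' p hu hu' hp h1 hlt).elim
    · rfl
    · exact (key u' u p hu' hu hp h1.symm hlt).elim
  have hopen : IsOpen (Ioo (u₀ - ε) (u₀ + ε) ×ˢ Metric.ball p₀ ε) :=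
    isOpen_Ioo.prod Metric.isOpen_ball
  have hmap : IsOpenMap ((Ioo (u₀ - ε) (u₀ + ε) ×ˢ Metric.ball p₀ ε).domRestrict
      fun z : ℝ × P => (α z, z.2)) := by
    rw [isOpenMap_iff_nhds_le]
    rintro ⟨z, hz⟩ s hs
    rw [mem_map, mem_nhds_subtype] at hs
    obtain ⟨t, ht, hts⟩ := hs
    refine mem_of_superset (image_mem_nhds_of_hasDerivAt_fst_ne hα hα' hderiv (hball hz)
      (inter_mem ht (hopen.mem_nhds hz))) ?_
    rintro _ ⟨x, hx, rfl⟩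
    exact hts (a := ⟨x, hx.2⟩) hx.1
  let h : OpenPartialHomeomorph (ℝ × P) (ℝ × P) :=
    OpenPartialHomeomorph.ofContinuousOpenRestrict (hinj.toPartialEquiv _ _)
      (hα.prodMk continuous_snd).continuousOn hmap hopen
  have happ (z) : h z = (α z, z.2) := rfl
  have hsrc : h.source = Ioo (u₀ - ε) (u₀ + ε) ×ˢ Metric.ball p₀ ε := rfl
  have hne (z) (hz : z ∈ h.source) : α' z ≠ 0 := hball (hsrc ▸ hz)
  have hsnd (y) (hy : y ∈ h.target) : (h.symm y).2 = y.2 :=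
    (congrArg Prod.snd (happ _)).symm.trans (congrArg Prod.snd (h.right_inv hy))
  refine ⟨h, ?_, happ, hne, hsnd, fun y hy => ?_⟩
  · rw [hsrc]
    exact mk_mem_prod ⟨by linarith, by linarith⟩ (Metric.mem_ball_self hε)
  · have hc : ContinuousAt (fun s : ℝ => (s, y.2)) y.1 := by fun_prop
    refine HasDerivAt.of_local_left_inverse (f := fun u => α (u, y.2)) ?_ ?_
      (hne _ (h.map_target hy)) ?_
    · exact continuous_fst.continuousAt.comp ((h.continuousAt_symm hy).comp hc)
    · have := hderiv (h.symm y)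
      rw [hsnd y hy] at this
      exact this
    · filter_upwards [hc.preimage_mem_nhds (h.open_target.mem_nhds hy)] with s hs
      have h1 := h.right_inv hs
      have h2 := hsnd _ hs
      rw [happ] at h1
      have h3 := congrArg Prod.fst h1
      simp only at h2 h3
      change α ((h.symm (s, y.2)).1, y.2) = s
      have h4 : ((h.symm (s, y.2)).1, y.2) = h.symm (s, y.2) := Prod.ext rfl h2.symm
      rw [h4]
      exact h3

/-- For r = 0 this is continuity of the inverse. For r ≥ 1 the derivative is block triangular with
diagonal entries α' and the identity, so the inverse function theorem applies. -/
theorem contDiffOn_symm_graph {P : Type*} [NormedAddCommGroup P] [NormedSpace ℝ P]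
    [CompleteSpace P] {r : ℕ∞} {α α' : ℝ × P → ℝ} (hα : ContDiff ℝ r α)
    (hderiv : ∀ z : ℝ × P, HasDerivAt (fun u => α (u, z.2)) (α' z) z.1)
    {h : OpenPartialHomeomorph (ℝ × P) (ℝ × P)} (happ : ∀ z, h z = (α z, z.2))
    (hne : ∀ z ∈ h.source, α' z ≠ 0) : ContDiffOn ℝ r h.symm h.target := by
  rcases eq_or_ne r 0 with rfl | hr
  · exact contDiffOn_zero.2 h.continuousOn_symm
  intro y hy
  refine ContDiffAt.contDiffWithinAt ?_
  have hr' : (r : WithTop ℕ∞) ≠ 0 := by exact_mod_cast hr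
  set z := h.symm y
  have hd : HasFDerivAt α (fderiv ℝ α z) z := (hα.differentiable hr' z).hasFDerivAt
  have h1 : fderiv ℝ α z (1, 0) = α' z :=
    (hd.comp_hasDerivAt z.1 ((hasDerivAt_id z.1).prodMk (hasDerivAt_const z.1 z.2))).unique
      (hderiv z)
  have hz0 : α' z ≠ 0 := hne z (h.map_target hy)
  have hlin (x : ℝ) (p : P) : fderiv ℝ α z (x, p) = x * α' z + fderiv ℝ α z (0, p) := by
    have : ((x, p) : ℝ × P) = x • ((1, 0) : ℝ × P) + (0, p) := by ext <;> simp
    rw [this, map_add, map_smul, h1, smul_eq_mul]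
  let L : (ℝ × P) ≃L[ℝ] ℝ × P := ContinuousLinearEquiv.equivOfInverse
    ((fderiv ℝ α z).prod (ContinuousLinearMap.snd ℝ ℝ P))
    (((α' z)⁻¹ • (ContinuousLinearMap.fst ℝ ℝ P - (fderiv ℝ α z).comp
      ((0 : ℝ × P →L[ℝ] ℝ).prod (ContinuousLinearMap.snd ℝ ℝ P)))).prod
        (ContinuousLinearMap.snd ℝ ℝ P))
    (fun w => by
      obtain ⟨x, p⟩ := w
      refine Prod.ext ?_ rfl
      simp [hlin x p, mul_comm x, hz0])
    (fun w => by
      obtain ⟨x, p⟩ := w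
      refine Prod.ext ?_ rfl
      simp only [ContinuousLinearMap.prod_apply, smul_apply, sub_apply,
        ContinuousLinearMap.comp_apply, zero_apply, ContinuousLinearMap.coe_fst',
        ContinuousLinearMap.coe_snd', smul_eq_mul]
      rw [hlin]
      field_simp
      ring)
  have hfun : (h : ℝ × P → ℝ × P) = fun z => (α z, z.2) := funext happ
  refine h.contDiffAt_symm (f₀' := L) hy ?_ ?_
  · rw [hfun]
    exact hd.prodMk hasFDerivAt_snd
  · rw [hfun]
    exact (hα.prodMk contDiff_snd).contDiffAt

end GraphMap

end ContactFoliation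

end

/-! ### Flowing out of a transverse slice -/

noncomputable section

namespace ContactFoliation

open Filter Topology

theorem exists_transversal_equiv {E : Type*} [NormedAddCommGroup E] [NormedSpace ℝ E]
    [FiniteDimensional ℝ E] {q : ℕ} (hdim : finrank ℝ E = 2 + q) {R : Fin q → E}
    (hR : LinearIndependent ℝ R) :
    ∃ (e₁ e₂ : E) (L : (ℝ × ℝ × (Fin q → ℝ)) ≃L[ℝ] E),
      ∀ w, L w = w.1 • e₁ + w.2.1 • e₂ + ∑ j, w.2.2 j • R j := by
  obtain ⟨C, hC⟩ := Submodule.exists_isCompl (Submodule.span ℝ (range R))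
  have hfC : finrank ℝ C = 2 := by
    have h1 := Submodule.finrank_add_eq_of_isCompl hC
    rw [finrank_span_eq_card hR, Fintype.card_fin, hdim] at h1
    omega
  let b : Basis (Fin 2) ℝ C := finBasisOfFinrankEq ℝ C hfC
  let L₀ : (ℝ × ℝ × (Fin q → ℝ)) →ₗ[ℝ] E :=
    (LinearMap.fst ℝ ℝ (ℝ × (Fin q → ℝ))).smulRight (b 0 : E) +
      ((LinearMap.fst ℝ ℝ (Fin q → ℝ)).comp (LinearMap.snd ℝ ℝ (ℝ × (Fin q → ℝ)))).smulRight
        (b 1 : E) +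
      ∑ j, ((LinearMap.proj (R := ℝ) (φ := fun _ : Fin q => ℝ) j).comp
        ((LinearMap.snd ℝ ℝ (Fin q → ℝ)).comp
          (LinearMap.snd ℝ ℝ (ℝ × (Fin q → ℝ))))).smulRight (R j)
  have hL₀ (w) : L₀ w = w.1 • (b 0 : E) + w.2.1 • (b 1 : E) + ∑ j, w.2.2 j • R j := by
    simp [L₀]
  have hinj : Function.Injective L₀ := by
    rw [injective_iff_map_eq_zero]
    rintro ⟨u, v, t⟩ hw
    rw [hL₀] at hw
    have h1 : ∑ j, t j • R j ∈ Submodule.span ℝ (range R) :=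
      Submodule.sum_mem _ fun j _ => Submodule.smul_mem _ _ (Submodule.subset_span ⟨j, rfl⟩)
    have h2 : u • (b 0 : E) + v • (b 1 : E) ∈ C :=
      C.add_mem (C.smul_mem _ (b 0).2) (C.smul_mem _ (b 1).2)
    have h3 : ∑ j, t j • R j ∈ C := by
      rw [← neg_eq_of_add_eq_zero_right hw]
      exact C.neg_mem h2
    have h4 : ∑ j, t j • R j = 0 := Submodule.disjoint_def.1 hC.disjoint _ h1 h3
    have ht : t = 0 := funext (Fintype.linearIndependent_iff.1 hR t h4)
    have h5 : u • b 0 + v • b 1 = 0 := by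
      apply Subtype.ext
      simpa [h4] using hw
    have h6 := Fintype.linearIndependent_iff.1 b.linearIndependent ![u, v]
      (by simpa [Fin.sum_univ_two] using h5)
    have hu := h6 0
    have hv := h6 1
    simp only [Matrix.cons_val_zero, Matrix.cons_val_one] at hu hv
    simp [hu, hv, ht]
  have hfin : finrank ℝ (ℝ × ℝ × (Fin q → ℝ)) = finrank ℝ E := by
    rw [hdim]
    simp
    omega
  refine ⟨b 0, b 1, (L₀.linearEquivOfInjective hinj hfin).toContinuousLinearEquiv, fun w => ?_⟩
  simpa using hL₀ w

/-- Near every point there are coordinates `(u, v, t_1, …, t_q)` in which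
`λ_i = f_i(u, v) du + g_i(u, v) dv + dt_i`. -/
theorem exists_reeb_parametrization {E : Type*} [NormedAddCommGroup E] [NormedSpace ℝ E]
    [FiniteDimensional ℝ E] {q : ℕ} (hdim : finrank ℝ E = 2 + q) {r m : ℕ∞} (hm : 1 ≤ m)
    {O : Set E} (hO : IsOpen O) {x₀ : E} (hx₀ : x₀ ∈ O) {η : Fin q → E → E →L[ℝ] ℝ}
    {R : Fin q → E → E} (hη : ∀ i, ContDiffOn ℝ (r + 1 : ℕ∞) (η i) O)
    (hR : ∀ j, ContDiffOn ℝ m (R j) O)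
    (hηR : ∀ i j, ∀ x ∈ O, η i x (R j x) = if i = j then 1 else 0)
    (hker : ∀ i j, ∀ x ∈ O, ∀ w,
      fderiv ℝ (η i) x (R j x) w - fderiv ℝ (η i) x w (R j x) = 0) :
    ∃ (Φ : OpenPartialHomeomorph (ℝ × ℝ × (Fin q → ℝ)) E) (f g : Fin q → ℝ × ℝ → ℝ),
      0 ∈ Φ.source ∧ Φ 0 = x₀ ∧ Φ.target ⊆ O ∧ ContDiffOn ℝ m Φ Φ.source ∧
      ContDiffOn ℝ m Φ.symm Φ.target ∧ (∀ i, ContDiff ℝ (r + 1 : ℕ∞) (f i)) ∧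
      (∀ i, ContDiff ℝ (r + 1 : ℕ∞) (g i)) ∧
      ∀ p ∈ Φ.source, ∀ i w, η i (Φ p) (fderiv ℝ Φ p w) =
        f i (p.1, p.2.1) * w.1 + g i (p.1, p.2.1) * w.2.1 + w.2.2 i := by
  have : CompleteSpace E := FiniteDimensional.complete ℝ E
  have hmne : ((m : ℕ∞) : WithTop ℕ∞) ≠ 0 := by
    exact_mod_cast (zero_lt_one.trans_le hm).ne'
  have hrne : ((r + 1 : ℕ∞) : WithTop ℕ∞) ≠ 0 := by
    exact_mod_cast (zero_lt_one.trans_le le_add_self).ne'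
  have hηd (i) (x) (hx : x ∈ O) : DifferentiableAt ℝ (η i) x :=
    ((hη i).contDiffAt (hO.mem_nhds hx)).differentiableAt hrne
  have hRlin : LinearIndependent ℝ fun j => R j x₀ := by
    rw [Fintype.linearIndependent_iff]
    intro c hc i
    simpa [hηR i _ x₀ hx₀] using congrArg (η i x₀) hc
  obtain ⟨e₁, e₂, L, hL⟩ := exists_transversal_equiv hdim hRlin
  obtain ⟨Ψ, hΨ, hΨ0, hΨ', hΨη⟩ := exists_reeb_flow hm hO hx₀ hηd hR hηR hker
  -- The planar normal form wants f and g of class C^{r+1} on the whole plane; the cut-off forms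
  -- agree with the original ones only near x₀, which shrinks the domain below.
  choose η' hη' _ hηη' using fun i => exists_contDiff_hasCompactSupport_eventuallyEq hO hx₀ (hη i)
  -- the transversal
  let ℓ : ℝ × ℝ →L[ℝ] E := (ContinuousLinearMap.fst ℝ ℝ ℝ).smulRight e₁ +
    (ContinuousLinearMap.snd ℝ ℝ ℝ).smulRight e₂
  have hℓ (z) : ℓ z = z.1 • e₁ + z.2 • e₂ := rfl
  let pr : ℝ × ℝ × (Fin q → ℝ) →L[ℝ] ℝ × ℝ :=
    (ContinuousLinearMap.fst ℝ ℝ (ℝ × (Fin q → ℝ))).prod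
      ((ContinuousLinearMap.fst ℝ ℝ (Fin q → ℝ)).comp
        (ContinuousLinearMap.snd ℝ ℝ (ℝ × (Fin q → ℝ))))
  let ι : ℝ × ℝ × (Fin q → ℝ) →L[ℝ] E × (Fin q → ℝ) := (ℓ.comp pr).prod
    ((ContinuousLinearMap.snd ℝ ℝ (Fin q → ℝ)).comp
      (ContinuousLinearMap.snd ℝ ℝ (ℝ × (Fin q → ℝ))))
  let σ : ℝ × ℝ × (Fin q → ℝ) → E × (Fin q → ℝ) := fun p => (x₀, 0) + ι p
  have hσ : ContDiff ℝ m σ := contDiff_const.add ι.contDiff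
  have hσ0 : σ 0 = (x₀, 0) := by simp [σ]
  have hσ' (p) : HasFDerivAt σ ι p := ι.hasFDerivAt.const_add _
  have hσ1 (p) : (σ p).1 = x₀ + ℓ (p.1, p.2.1) := rfl
  have hΦ' (p) : HasFDerivAt (Ψ ∘ σ) ((fderiv ℝ Ψ (σ p)).comp ι) p :=
    ((hΨ.differentiable hmne (σ p)).hasFDerivAt).comp p (hσ' p)
  have hΦ0 : HasFDerivAt (Ψ ∘ σ) (L : (ℝ × ℝ × (Fin q → ℝ)) →L[ℝ] E) 0 := by
    refine (hΦ' 0).congr_fderiv ?_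
    refine ContinuousLinearMap.ext fun w => ?_
    rw [ContinuousLinearMap.comp_apply, hσ0, hΨ']
    exact (hL w).symm
  have hΦc : ContDiff ℝ m (Ψ ∘ σ) := hΨ.comp hσ
  let Φ₀ := hΦc.contDiffAt.toOpenPartialHomeomorph (Ψ ∘ σ) hΦ0 hmne
  have hΦ₀ : (Φ₀ : ℝ × ℝ × (Fin q → ℝ) → E) = Ψ ∘ σ :=
    hΦc.contDiffAt.toOpenPartialHomeomorph_coe hΦ0 hmne
  have hmem : (0 : ℝ × ℝ × (Fin q → ℝ)) ∈ Φ₀.source :=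
    hΦc.contDiffAt.mem_toOpenPartialHomeomorph_source hΦ0 hmne
  -- The coefficients of λ_i on the affine slice: the flow does not enter, so they keep the class
  -- C^{r+1}.
  let f : Fin q → ℝ × ℝ → ℝ := fun i z => η' i (x₀ + ℓ z) e₁
  let g : Fin q → ℝ × ℝ → ℝ := fun i z => η' i (x₀ + ℓ z) e₂
  have hη'ℓ (i) : ContDiff ℝ (r + 1 : ℕ∞) fun z => η' i (x₀ + ℓ z) :=
    (hη' i).comp (contDiff_const.add ℓ.contDiff)
  have hσt : Tendsto σ (𝓝 0) (𝓝 (x₀, 0)) := by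
    simpa only [hσ0] using hσ.continuous.tendsto 0
  have hN : ∀ᶠ p in 𝓝 (0 : ℝ × ℝ × (Fin q → ℝ)),
      (∃ L : (ℝ × ℝ × (Fin q → ℝ)) ≃L[ℝ] E,
        (L : (ℝ × ℝ × (Fin q → ℝ)) →L[ℝ] E) = fderiv ℝ (Ψ ∘ σ) p) ∧
      Ψ (σ p) ∈ O ∧ ∀ i w, η i (Ψ (σ p)) (fderiv ℝ (Ψ ∘ σ) p w) =
        f i (p.1, p.2.1) * w.1 + g i (p.1, p.2.1) * w.2.1 + w.2.2 i := by
    -- Invertible maps form an open set; invertibility on all of N is what makes the inverse of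
    -- class C^m on the whole target.
    have h1 : ∀ᶠ p in 𝓝 (0 : ℝ × ℝ × (Fin q → ℝ)), fderiv ℝ (Ψ ∘ σ) p ∈
        range ((↑) : ((ℝ × ℝ × (Fin q → ℝ)) ≃L[ℝ] E) → _) := by
      have hc : Continuous (fderiv ℝ (Ψ ∘ σ)) := hΦc.continuous_fderiv hmne
      refine hc.continuousAt.preimage_mem_nhds ?_
      rw [hΦ0.fderiv]
      exact ContinuousLinearEquiv.nhds L
    have h2 : ∀ᶠ p in 𝓝 (0 : ℝ × ℝ × (Fin q → ℝ)), ∀ i, η' i (σ p).1 = η i (σ p).1 := by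
      rw [eventually_all]
      intro i
      exact ((continuous_fst.tendsto _).comp hσt).eventually (hηη' i)
    filter_upwards [h1, h2, hσt.eventually hΨη] with p hp1 hp2 hp3
    refine ⟨hp1, hp3.1, fun i w => ?_⟩
    rw [(hΦ' p).fderiv, ContinuousLinearMap.comp_apply, hp3.2.2, ← hp2 i, hσ1]
    have h3 : (ι w).1 = w.1 • e₁ + w.2.1 • e₂ := rfl
    have h4 : (ι w).2 = w.2.2 := rfl
    rw [h3, h4, map_add, map_smul, map_smul, smul_eq_mul, smul_eq_mul]
    ring
  obtain ⟨N, hNsub, hNo, hN0⟩ := mem_nhds_iff.1 hN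
  let Φ := Φ₀.restrOpen N hNo
  have hΦ : (Φ : ℝ × ℝ × (Fin q → ℝ) → E) = Ψ ∘ σ := hΦ₀
  have hsrc {p} (hp : p ∈ Φ.source) : p ∈ N := by
    rw [Φ₀.restrOpen_source] at hp
    exact hp.2
  refine ⟨Φ, f, g, ?_, ?_, ?_, ?_, ?_, fun i => (hη'ℓ i).clm_apply contDiff_const,
    fun i => (hη'ℓ i).clm_apply contDiff_const, ?_⟩
  · rw [Φ₀.restrOpen_source]
    exact ⟨hmem, hN0⟩
  · rw [hΦ, Function.comp_apply, hσ0, hΨ0]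
  · intro x hx
    have h1 := hsrc (Φ.map_target hx)
    rw [← Φ.right_inv hx, hΦ]
    exact (hNsub h1).2.1
  · rw [hΦ]
    exact hΦc.contDiffOn
  · intro x hx
    obtain ⟨L', hL'⟩ := (hNsub (hsrc (Φ.map_target hx))).1
    refine (Φ.contDiffAt_symm (f₀' := L') hx ?_ ?_).contDiffWithinAt
    · rw [hL', hΦ]
      exact (hΦc.differentiable hmne _).hasFDerivAt
    · rw [hΦ]
      exact hΦc.contDiffAt
  · intro p hp i w
    rw [hΦ]
    exact (hNsub (hsrc hp)).2.2 i w

end ContactFoliation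

end

/-! ### The normal form in a vector space -/

noncomputable section

namespace ContactFoliation

open Filter Topology

/-- The shear `(u, v, t) ↦ (u, v, t + W(u, v))`. -/
def shear {q : ℕ} {W : Fin q → ℝ × ℝ → ℝ} (hW : ∀ i, Continuous (W i)) :
    (ℝ × ℝ × (Fin q → ℝ)) ≃ₜ (ℝ × ℝ × (Fin q → ℝ)) where
  toFun p := (p.1, p.2.1, fun i => p.2.2 i + W i (p.1, p.2.1))
  invFun p := (p.1, p.2.1, fun i => p.2.2 i - W i (p.1, p.2.1))
  left_inv p := by simp
  right_inv p := by simp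
  continuous_toFun := by fun_prop
  continuous_invFun := by fun_prop

/-- In coordinates d(f du + g dv + dt_i) = (∂_u g - ∂_v f) du∧dv, and d commutes with pullback by
the C^1 map Φ. -/
theorem fderiv_skew_of_planar {E : Type*} [NormedAddCommGroup E] [NormedSpace ℝ E] {q : ℕ}
    {η : E → E →L[ℝ] ℝ} {Φ : ℝ × ℝ × (Fin q → ℝ) → E} {f g : ℝ × ℝ → ℝ} {i : Fin q}
    {N : Set (ℝ × ℝ × (Fin q → ℝ))} (hN : IsOpen N) (hΦ : ContDiffOn ℝ 1 Φ N)
    (hf : Differentiable ℝ f) (hg : Differentiable ℝ g)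
    (hform : ∀ p ∈ N, ∀ w, η (Φ p) (fderiv ℝ Φ p w) =
        f (p.1, p.2.1) * w.1 + g (p.1, p.2.1) * w.2.1 + w.2.2 i)
    {p : ℝ × ℝ × (Fin q → ℝ)} (hp : p ∈ N) (hη : DifferentiableAt ℝ η (Φ p))
    (v w : ℝ × ℝ × (Fin q → ℝ)) :
    fderiv ℝ η (Φ p) (fderiv ℝ Φ p v) (fderiv ℝ Φ p w) -
        fderiv ℝ η (Φ p) (fderiv ℝ Φ p w) (fderiv ℝ Φ p v) =
      (fderiv ℝ g (p.1, p.2.1) (1, 0) - fderiv ℝ f (p.1, p.2.1) (0, 1)) *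
        (v.1 * w.2.1 - v.2.1 * w.1) := by
  let pr : ℝ × ℝ × (Fin q → ℝ) →L[ℝ] ℝ × ℝ :=
    (ContinuousLinearMap.fst ℝ ℝ (ℝ × (Fin q → ℝ))).prod
      ((ContinuousLinearMap.fst ℝ ℝ (Fin q → ℝ)).comp
        (ContinuousLinearMap.snd ℝ ℝ (ℝ × (Fin q → ℝ))))
  let du : ℝ × ℝ × (Fin q → ℝ) →L[ℝ] ℝ := (ContinuousLinearMap.fst ℝ ℝ ℝ).comp pr
  let dv : ℝ × ℝ × (Fin q → ℝ) →L[ℝ] ℝ := (ContinuousLinearMap.snd ℝ ℝ ℝ).comp pr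
  let dt : ℝ × ℝ × (Fin q → ℝ) →L[ℝ] ℝ :=
    (ContinuousLinearMap.proj (R := ℝ) (φ := fun _ : Fin q => ℝ) i).comp
      ((ContinuousLinearMap.snd ℝ ℝ (Fin q → ℝ)).comp
        (ContinuousLinearMap.snd ℝ ℝ (ℝ × (Fin q → ℝ))))
  let μ : ℝ × ℝ × (Fin q → ℝ) → (ℝ × ℝ × (Fin q → ℝ)) →L[ℝ] ℝ := fun p =>
    f (pr p) • du + g (pr p) • dv + dt
  have hμ : HasFDerivAt μ ((((fderiv ℝ f (pr p)).comp pr).smulRight du +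
      ((fderiv ℝ g (pr p)).comp pr).smulRight dv)) p := by
    have h1 : HasFDerivAt (fun p => f (pr p)) ((fderiv ℝ f (pr p)).comp pr) p :=
      (hf (pr p)).hasFDerivAt.comp p pr.hasFDerivAt
    have h2 : HasFDerivAt (fun p => g (pr p)) ((fderiv ℝ g (pr p)).comp pr) p :=
      (hg (pr p)).hasFDerivAt.comp p pr.hasFDerivAt
    exact ((h1.smul_const du).fun_add (h2.smul_const dv)).add_const dt
  have hμΦ : ∀ᶠ y in 𝓝 p, μ y = (η (Φ y)).comp (fderiv ℝ Φ y) := by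
    filter_upwards [hN.mem_nhds hp] with y hy
    refine ContinuousLinearMap.ext fun w => ?_
    rw [ContinuousLinearMap.comp_apply, hform y hy]
    rfl
  rw [← fderiv_skew_of_eventuallyEq_pullback (hΦ.contDiffAt (hN.mem_nhds hp)) hη
    hμ.differentiableAt hμΦ v w, hμ.fderiv]
  have hlin (A : ℝ × ℝ →L[ℝ] ℝ) (z) : A (pr z) = z.1 * A (1, 0) + z.2.1 * A (0, 1) := by
    have : pr z = z.1 • ((1, 0) : ℝ × ℝ) + z.2.1 • ((0, 1) : ℝ × ℝ) := by
      ext <;> simp [pr]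
    rw [this, map_add, map_smul, map_smul, smul_eq_mul, smul_eq_mul]
  have hdu (z) : du z = z.1 := rfl
  have hdv (z) : dv z = z.2.1 := rfl
  have hpr : pr p = (p.1, p.2.1) := rfl
  simp only [add_apply, ContinuousLinearMap.smulRight_apply, ContinuousLinearMap.comp_apply, hlin,
    smul_apply, hdu, hdv, smul_eq_mul, hpr]
  ring

/-- The normal form of a `q`-contact structure of codimension `2` on an open set of a vector
space. -/
theorem exists_local_normal_form {E : Type*} [NormedAddCommGroup E] [NormedSpace ℝ E]
    [FiniteDimensional ℝ E] {q : ℕ} (hdim : finrank ℝ E = 2 + q) {r m : ℕ∞} (hm : 1 ≤ m)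
    (hrm : r ≤ m) (i₀ : Fin q)
    {O : Set E} (hO : IsOpen O) {x₀ : E} (hx₀ : x₀ ∈ O) {η : Fin q → E → E →L[ℝ] ℝ}
    {R : Fin q → E → E} (hη : ∀ i, ContDiffOn ℝ (r + 1 : ℕ∞) (η i) O)
    (hR : ∀ j, ContDiffOn ℝ m (R j) O)
    (hηR : ∀ i j, ∀ x ∈ O, η i x (R j x) = if i = j then 1 else 0)
    (hker : ∀ i j, ∀ x ∈ O, ∀ w,
      fderiv ℝ (η i) x (R j x) w - fderiv ℝ (η i) x w (R j x) = 0)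
    (hne : ∀ i, ∀ x ∈ O, ∃ v w, fderiv ℝ (η i) x v w - fderiv ℝ (η i) x w v ≠ 0) :
    ∃ (φ : OpenPartialHomeomorph E (ℝ × ℝ × (Fin q → ℝ))) (A : Fin q → ℝ × ℝ → ℝ)
      (π : E → ℝ × ℝ), x₀ ∈ φ.source ∧ φ.source ⊆ O ∧ ContDiffOn ℝ r φ φ.source ∧
      ContDiffOn ℝ r φ.symm φ.target ∧ ContDiffOn ℝ 1 (fun x => (φ x).2.1) φ.source ∧
      (∀ i, ContDiffOn ℝ 1 (fun x => (φ x).2.2 i) φ.source) ∧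
      ContDiffOn ℝ m π φ.source ∧ (∀ i, ContDiff ℝ r (A i)) ∧
      (∀ x ∈ φ.source, ∀ v, (∀ w, fderiv ℝ (η i₀) x v w - fderiv ℝ (η i₀) x w v = 0) →
        fderiv ℝ π x v = 0) ∧
      (∀ i, ∀ x ∈ φ.source,
        deriv (fun s => A i (π (φ.symm (s, (φ x).2)))) (φ x).1 ≠ 0) ∧
      (∀ i, ∀ x ∈ φ.source, ∀ v, η i x v =
        fderiv ℝ (fun x => (φ x).2.2 i) x v + A i (π x) * fderiv ℝ (fun x => (φ x).2.1) x v) ∧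
      ∀ x ∈ φ.source, A i₀ (π x) = (φ x).1 := by
  have hmne : ((m : ℕ∞) : WithTop ℕ∞) ≠ 0 := by
    exact_mod_cast (zero_lt_one.trans_le hm).ne'
  have hrne : ((r + 1 : ℕ∞) : WithTop ℕ∞) ≠ 0 := by
    exact_mod_cast (zero_lt_one.trans_le le_add_self).ne'
  have hr1 : ((1 : ℕ∞) : WithTop ℕ∞) ≤ (r + 1 : ℕ∞) := by exact_mod_cast le_add_self
  have hrr : ((r : ℕ∞) : WithTop ℕ∞) ≤ (r + 1 : ℕ∞) := by exact_mod_cast le_self_add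
  have hm1 : ((1 : ℕ∞) : WithTop ℕ∞) ≤ m := by exact_mod_cast hm
  have hrm' : ((r : ℕ∞) : WithTop ℕ∞) ≤ m := by exact_mod_cast hrm
  obtain ⟨Φ, f, g, h0, hΦ0, hΦO, hΦ, hΦs, hf, hg, hform⟩ :=
    exists_reeb_parametrization hdim hm hO hx₀ hη hR hηR hker
  have hΦs' {x} (hx : x ∈ Φ.target) : HasFDerivAt Φ.symm (fderiv ℝ Φ.symm x) x :=
    ((hΦs.contDiffAt (Φ.open_target.mem_nhds hx)).differentiableAt hmne).hasFDerivAt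
  have hΦ' {p} (hp : p ∈ Φ.source) : HasFDerivAt Φ (fderiv ℝ Φ p) p :=
    ((hΦ.contDiffAt (Φ.open_source.mem_nhds hp)).differentiableAt hmne).hasFDerivAt
  have hinv {x} (hx : x ∈ Φ.target) (v : E) :
      fderiv ℝ Φ (Φ.symm x) (fderiv ℝ Φ.symm x v) = v := by
    have h1 := (hΦ' (Φ.map_target hx)).comp x (hΦs' hx)
    have h2 : (Φ ∘ Φ.symm) =ᶠ[𝓝 x] id := by
      filter_upwards [Φ.open_target.mem_nhds hx] with y hy using Φ.right_inv hy
    exact congrArg (fun A : E →L[ℝ] E => A v)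
      ((h1.congr_of_eventuallyEq h2.symm).unique (hasFDerivAt_id x))
  have hinv' {x} (hx : x ∈ Φ.target) (w) :
      fderiv ℝ Φ.symm x (fderiv ℝ Φ (Φ.symm x) w) = w := by
    have h3 : HasFDerivAt Φ.symm (fderiv ℝ Φ.symm x) (Φ (Φ.symm x)) := by
      rw [Φ.right_inv hx]
      exact hΦs' hx
    have h1 := h3.comp (Φ.symm x) (hΦ' (Φ.map_target hx))
    have h2 : (Φ.symm ∘ Φ) =ᶠ[𝓝 (Φ.symm x)] id := by
      filter_upwards [Φ.open_source.mem_nhds (Φ.map_target hx)] with y hy using Φ.left_inv hy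
    exact congrArg (fun A : (ℝ × ℝ × (Fin q → ℝ)) →L[ℝ] _ => A w)
      ((h1.congr_of_eventuallyEq h2.symm).unique (hasFDerivAt_id _))
  have hskew (i) {x} (hx : x ∈ Φ.target) (v w : E) :
      fderiv ℝ (η i) x v w - fderiv ℝ (η i) x w v =
        (fderiv ℝ (g i) ((Φ.symm x).1, (Φ.symm x).2.1) (1, 0) -
          fderiv ℝ (f i) ((Φ.symm x).1, (Φ.symm x).2.1) (0, 1)) *
        ((fderiv ℝ Φ.symm x v).1 * (fderiv ℝ Φ.symm x w).2.1 -
          (fderiv ℝ Φ.symm x v).2.1 * (fderiv ℝ Φ.symm x w).1) := by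
    have hη' : DifferentiableAt ℝ (η i) (Φ (Φ.symm x)) := by
      rw [Φ.right_inv hx]
      exact ((hη i).contDiffAt (hO.mem_nhds (hΦO hx))).differentiableAt hrne
    have := fderiv_skew_of_planar Φ.open_source (hΦ.of_le hm1) ((hf i).differentiable hrne)
      ((hg i).differentiable hrne) (fun p hp w => hform p hp i w) (Φ.map_target hx) hη'
      (fderiv ℝ Φ.symm x v) (fderiv ℝ Φ.symm x w)
    rwa [hinv hx, hinv hx, Φ.right_inv hx] at this
  have hc (i) {x} (hx : x ∈ Φ.target) :
      fderiv ℝ (g i) ((Φ.symm x).1, (Φ.symm x).2.1) (1, 0) -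
          fderiv ℝ (f i) ((Φ.symm x).1, (Φ.symm x).2.1) (0, 1) ≠ 0 := by
    intro h
    obtain ⟨v, w, hvw⟩ := hne i x (hΦO hx)
    rw [hskew i hx, h, zero_mul] at hvw
    exact hvw rfl
  choose W A hW hA hA' hWA using fun i => exists_planar_normal_form (hf i) (hg i)
  have hWd (i) : Differentiable ℝ (W i) := (hW i).differentiable hrne
  -- the local homeomorphism `(u, v, z) ↦ (a(u, v), v, z)`
  let α : ℝ × ℝ × (Fin q → ℝ) → ℝ := fun p => A i₀ (p.1, p.2.1)
  let α' : ℝ × ℝ × (Fin q → ℝ) → ℝ := fun p =>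
    fderiv ℝ (g i₀) (p.1, p.2.1) (1, 0) - fderiv ℝ (f i₀) (p.1, p.2.1) (0, 1)
  have hα : ContDiff ℝ r α := (hA i₀).comp (contDiff_fst.prodMk contDiff_snd.fst)
  have hpr : Continuous fun p : ℝ × ℝ × (Fin q → ℝ) => (p.1, p.2.1) := by fun_prop
  have hα' : Continuous α' :=
    ((((hg i₀).continuous_fderiv hrne).comp hpr).clm_apply continuous_const).sub
      ((((hf i₀).continuous_fderiv hrne).comp hpr).clm_apply continuous_const)
  have hαd (z : ℝ × ℝ × (Fin q → ℝ)) : HasDerivAt (fun u => α (u, z.2)) (α' z) z.1 :=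
    hA' i₀ (z.1, z.2.1)
  let Sh := shear fun i => (hW i).continuous
  have hx₀t : x₀ ∈ Φ.target := by
    rw [← hΦ0]
    exact Φ.map_source h0
  have hΦs0 : Φ.symm x₀ = 0 := by rw [← hΦ0, Φ.left_inv h0]
  have hne0 : α' (Sh 0) ≠ 0 := by
    have := hc i₀ hx₀t
    rw [hΦs0] at this
    exact this
  obtain ⟨h, hSh0, happ, hneh, hsnd, hsymm⟩ :=
    exists_openPartialHomeomorph_graph hα.continuous hα' hαd hne0
  have hhs : ContDiffOn ℝ r h.symm h.target := contDiffOn_symm_graph hα hαd happ hneh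
  -- From (u, v, t) the shear gives z = t + W(u, v), then the graph map replaces u by x = a_{i₀}(u,
  -- v).
  let φ : OpenPartialHomeomorph E (ℝ × ℝ × (Fin q → ℝ)) :=
    Φ.symm.trans (Sh.toOpenPartialHomeomorph.trans h)
  let π : E → ℝ × ℝ := fun x => ((Φ.symm x).1, (Φ.symm x).2.1)
  have hsrc {x} (hx : x ∈ φ.source) : x ∈ Φ.target := by
    simp only [φ, OpenPartialHomeomorph.trans_source] at hx
    exact hx.1
  have hsrcsub : φ.source ⊆ Φ.target := fun x hx => hsrc hx
  have hφ (x) : φ x = (A i₀ (π x), (Φ.symm x).2.1,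
      fun i => (Φ.symm x).2.2 i + W i (π x)) := happ _
  have hφs (y) : φ.symm y = Φ (Sh.symm (h.symm y)) := rfl
  have htgt {y} (hy : y ∈ φ.target) : y ∈ h.target ∧ Sh.symm (h.symm y) ∈ Φ.source := by
    simp only [φ, OpenPartialHomeomorph.trans_target] at hy
    exact ⟨hy.1.1, hy.2⟩
  have hΦsφ : ContDiffOn ℝ m Φ.symm φ.source := hΦs.mono hsrcsub
  have hπ : ContDiffOn ℝ m π φ.source := hΦsφ.fst.prodMk hΦsφ.snd.fst
  have hy1 : ContDiffOn ℝ m (fun x => (φ x).2.1) φ.source := by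
    simp only [hφ]
    exact hΦsφ.snd.fst
  have hz1 {k : ℕ∞} (hk : k ≤ m) (hk' : k ≤ r + 1) (i) :
      ContDiffOn ℝ k (fun x => (φ x).2.2 i) φ.source := by
    simp only [hφ]
    have hk₁ : ((k : ℕ∞) : WithTop ℕ∞) ≤ m := by exact_mod_cast hk
    refine ContDiffOn.add ?_ (((hW i).of_le (by exact_mod_cast hk')).comp_contDiffOn
      (hπ.of_le hk₁))
    exact (contDiff_apply ℝ ℝ i).comp_contDiffOn (hΦsφ.of_le hk₁).snd.snd
  have hπ' {x} (hx : x ∈ φ.source) : HasFDerivAt π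
      (((ContinuousLinearMap.fst ℝ ℝ (ℝ × (Fin q → ℝ))).comp (fderiv ℝ Φ.symm x)).prod
      ((ContinuousLinearMap.fst ℝ ℝ (Fin q → ℝ)).comp
        ((ContinuousLinearMap.snd ℝ ℝ (ℝ × (Fin q → ℝ))).comp (fderiv ℝ Φ.symm x)))) x :=
    (hΦs' (hsrc hx)).fst.prodMk (hΦs' (hsrc hx)).snd.fst
  refine ⟨φ, A, π, ?_, fun x hx => hΦO (hsrc hx), ?_, ?_, hy1.of_le hm1,
    hz1 hm le_add_self, hπ, hA, ?_, ?_, ?_, fun x _ => by rw [hφ]⟩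
  · simp only [φ, OpenPartialHomeomorph.trans_source]
    refine ⟨hx₀t, trivial, ?_⟩
    rw [hΦs0]
    exact hSh0
  · have : (φ : E → _) = fun x => (A i₀ (π x), (φ x).2.1, fun i => (φ x).2.2 i) := by
      funext x
      rw [hφ]
    rw [this]
    exact ((hA i₀).comp_contDiffOn (hπ.of_le hrm')).prodMk
      ((hy1.of_le hrm').prodMk (contDiffOn_pi.2 (hz1 hrm le_self_add)))
  · have hShs : ContDiff ℝ r Sh.symm := by
      refine contDiff_fst.prodMk (contDiff_snd.fst.prodMk (contDiff_pi.2 fun i => ?_))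
      exact ((contDiff_apply ℝ ℝ i).comp contDiff_snd.snd).sub
        (((hW i).of_le hrr).comp (contDiff_fst.prodMk contDiff_snd.fst))
    exact (hΦ.of_le hrm').comp (hShs.comp_contDiffOn (hhs.mono fun y hy => (htgt hy).1))
      fun y hy => (htgt hy).2
  · intro x hx v hv
    have hxt := hsrc hx
    -- The form du∧dv annihilates v; testing against ∂_v and ∂_u kills its two planar components.
    have key (w : ℝ × ℝ × (Fin q → ℝ)) :
        (fderiv ℝ Φ.symm x v).1 * w.2.1 - (fderiv ℝ Φ.symm x v).2.1 * w.1 = 0 := by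
      have h1 := hv (fderiv ℝ Φ (Φ.symm x) w)
      rw [hskew i₀ hxt, hinv' hxt] at h1
      exact (mul_eq_zero.1 h1).resolve_left (hc i₀ hxt)
    rw [(hπ' hx).fderiv]
    have h1 := key (0, 1, 0)
    have h2 := key (1, 0, 0)
    simp only [mul_one, mul_zero, sub_zero, zero_sub, neg_eq_zero] at h1 h2
    exact Prod.ext h1 h2
  · intro i x hx
    set y := φ x with hy
    have hyt : y ∈ φ.target := φ.map_source hx
    have hyh := (htgt hyt).1
    have hhx : h.symm y = Sh (Φ.symm x) := by
      simp only [φ, OpenPartialHomeomorph.trans_source] at hx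
      exact h.left_inv hx.2.2
    have hU := hsymm y hyh
    have hev : (fun s => A i (π (φ.symm (s, y.2)))) =ᶠ[𝓝 y.1]
        fun s => A i ((h.symm (s, y.2)).1, y.2.1) := by
      have hcs : ContinuousAt (fun s : ℝ => (s, y.2)) y.1 := by fun_prop
      filter_upwards [hcs.preimage_mem_nhds (φ.open_target.mem_nhds hyt)] with s hs
      have h1 := hsnd _ (htgt hs).1
      have h2 : Φ.symm (φ.symm (s, y.2)) = Sh.symm (h.symm (s, y.2)) := by
        rw [hφs, Φ.left_inv (htgt hs).2]
      have h3 : π (φ.symm (s, y.2)) =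
          ((h.symm (s, y.2)).1, (h.symm (s, y.2)).2.1) := by
        simp only [π, h2]
        rfl
      rw [h3, h1]
    rw [hev.deriv_eq]
    have h1 : h.symm (y.1, y.2) = h.symm y := rfl
    have h2 : y.2.1 = (h.symm y).2.1 := by rw [hsnd y hyh]
    have h3 := (hA' i ((h.symm y).1, y.2.1))
    have h4 := HasDerivAt.comp y.1 (h := fun s => (h.symm (s, y.2)).1)
      (h₂ := fun u => A i (u, y.2.1)) h3 hU
    have h5 := h4.deriv
    rw [Function.comp_def] at h5
    rw [h5]
    -- The derivative is c_i / c_{i₀}. As `deriv` is 0 wherever a derivative fails to exist, its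
    -- nonvanishing also records existence.
    refine mul_ne_zero ?_ (inv_ne_zero (hneh _ (h.map_target hyh)))
    rw [h2, hhx]
    exact hc i (hsrc hx)
  · intro i x hx v
    have hxt := hsrc hx
    have h1 := hform _ (Φ.map_target hxt) i (fderiv ℝ Φ.symm x v)
    rw [hinv hxt, Φ.right_inv hxt] at h1
    have h2 := hWA i (π x) ((fderiv ℝ Φ.symm x v).1, (fderiv ℝ Φ.symm x v).2.1)
    have h7 : HasFDerivAt (fun x => (Φ.symm x).2.1) ((ContinuousLinearMap.fst ℝ ℝ (Fin q → ℝ)).comp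
        ((ContinuousLinearMap.snd ℝ ℝ (ℝ × (Fin q → ℝ))).comp (fderiv ℝ Φ.symm x))) x :=
      (hΦs' hxt).snd.fst
    have h3 := h7.congr_of_eventuallyEq (f₁ := fun x => (φ x).2.1)
      (Eventually.of_forall fun x => by simp only [hφ])
    let dt : ℝ × ℝ × (Fin q → ℝ) →L[ℝ] ℝ :=
      (ContinuousLinearMap.proj (R := ℝ) (φ := fun _ : Fin q => ℝ) i).comp
        ((ContinuousLinearMap.snd ℝ ℝ (Fin q → ℝ)).comp
          (ContinuousLinearMap.snd ℝ ℝ (ℝ × (Fin q → ℝ))))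
    have h5 : HasFDerivAt (fun x => (Φ.symm x).2.2 i) (dt.comp (fderiv ℝ Φ.symm x)) x :=
      dt.hasFDerivAt.comp x (hΦs' hxt)
    have h6 := (hWd i (π x)).hasFDerivAt.comp x (hπ' hx)
    have h4 := (h5.add h6).congr_of_eventuallyEq (f₁ := fun x => (φ x).2.2 i)
      (Eventually.of_forall fun x => by simp only [hφ]; rfl)
    rw [h3.fderiv, h4.fderiv, h1, h2]
    simp only [add_apply, ContinuousLinearMap.comp_apply]
    change _ = (fderiv ℝ Φ.symm x v).2.2 i + _ + A i (π x) * (fderiv ℝ Φ.symm x v).2.1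
    rw [add_comm, ← add_assoc]
    rfl

end ContactFoliation

end

/-! ### Regularity of the Reeb fields -/

noncomputable section

namespace ContactFoliation

open Filter Topology

/-- The solution `v` of a linear system `T v = s` with injective `T` is as smooth as the system. -/
theorem contDiffOn_of_clm_apply_eq {E G H : Type*} [NormedAddCommGroup E] [NormedSpace ℝ E]
    [NormedAddCommGroup G] [NormedSpace ℝ G] [FiniteDimensional ℝ G]
    [NormedAddCommGroup H] [NormedSpace ℝ H] [FiniteDimensional ℝ H] {k : WithTop ℕ∞}
    {O : Set E} (hO : IsOpen O) {T : E → G →L[ℝ] H} (hT : ContDiffOn ℝ k T O)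
    (hinj : ∀ x ∈ O, Function.Injective (T x)) {s : E → H} (hs : ContDiffOn ℝ k s O)
    {v : E → G} (hv : ∀ x ∈ O, T x (v x) = s x) : ContDiffOn ℝ k v O := by
  have : CompleteSpace G := FiniteDimensional.complete ℝ G
  intro x hx
  obtain ⟨P₀, hP₀⟩ := (T x : G →ₗ[ℝ] H).exists_leftInverse_of_injective
    (LinearMap.ker_eq_bot.2 (hinj x hx))
  let P : H →L[ℝ] G := LinearMap.toContinuousLinearMap P₀
  have hPT : P.comp (T x) = (ContinuousLinearEquiv.refl ℝ G : G →L[ℝ] G) :=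
    ContinuousLinearMap.ext fun y => LinearMap.congr_fun hP₀ y
  have hTx : ContDiffAt ℝ k T x := hT.contDiffAt (hO.mem_nhds hx)
  have hPTc : ContDiffAt ℝ k (fun y => P.comp (T y)) x := contDiffAt_const.clm_comp hTx
  have hinv : ContDiffAt ℝ k (fun y => ContinuousLinearMap.inverse (P.comp (T y))) x := by
    have h1 := contDiffAt_map_inverse (𝕜 := ℝ) (n := k) (ContinuousLinearEquiv.refl ℝ G)
    rw [← hPT] at h1
    exact h1.comp x hPTc
  have hev : ∀ᶠ y in 𝓝 x, P.comp (T y) ∈ range ((↑) : (G ≃L[ℝ] G) → G →L[ℝ] G) := by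
    refine hPTc.continuousAt.preimage_mem_nhds ?_
    rw [hPT]
    exact ContinuousLinearEquiv.nhds _
  refine ContDiffAt.contDiffWithinAt ?_
  refine (hinv.clm_apply ((contDiffAt_const (c := P)).clm_apply
    (hs.contDiffAt (hO.mem_nhds hx)))).congr_of_eventuallyEq ?_
  filter_upwards [hev, hO.mem_nhds hx] with y ⟨e, he⟩ hy
  rw [← he, ContinuousLinearMap.inverse_equiv, ← hv y hy]
  have : P (T y (v y)) = e (v y) := congrArg (fun A : G →L[ℝ] G => A (v y)) he.symm
  rw [this]
  exact (e.symm_apply_apply _).symm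

/-- The Reeb fields are of class `C^{max r 1}`. -/
theorem exists_reeb_fields {E : Type*} [NormedAddCommGroup E] [NormedSpace ℝ E]
    [FiniteDimensional ℝ E] {q : ℕ} {r : ℕ∞} (i₀ : Fin q) {O : Set E} (hO : IsOpen O)
    {η : Fin q → E → E →L[ℝ] ℝ} {Y : Fin q → E → E} {D : E → Submodule ℝ E}
    (hη : ∀ i, ContDiffOn ℝ (r + 1 : ℕ∞) (η i) O) (hY : ∀ j, ContDiffOn ℝ 1 (Y j) O)
    (hYlin : ∀ x ∈ O, LinearIndependent ℝ fun j => Y j x)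
    (hYD : ∀ x ∈ O, Submodule.span ℝ (range fun j => Y j x) = D x)
    (hD : ∀ i, ∀ x ∈ O, ∀ v, v ∈ D x ↔
      ∀ w, fderiv ℝ (η i) x v w - fderiv ℝ (η i) x w v = 0)
    (hcompl : ∀ x ∈ O, ∀ v ∈ D x, (∀ i, η i x v = 0) → v = 0) :
    ∃ R : Fin q → E → E, (∀ j, ContDiffOn ℝ (max r 1 : ℕ∞) (R j) O) ∧
      (∀ j, ∀ x ∈ O, R j x ∈ D x) ∧
      ∀ i j, ∀ x ∈ O, η i x (R j x) = if i = j then 1 else 0 := by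
  let T : E → (Fin q → ℝ) →L[ℝ] (Fin q → ℝ) := fun x => LinearMap.toContinuousLinearMap
    { toFun := fun c i => η i x (∑ k, c k • Y k x)
      map_add' := fun c c' => by
        ext i
        simp [add_smul, Finset.sum_add_distrib]
      map_smul' := fun a c => by
        ext i
        simp [mul_assoc, Finset.mul_sum] }
  have hTapp (x c i) : T x c i = η i x (∑ k, c k • Y k x) := rfl
  have hmem (x) (hx : x ∈ O) (c : Fin q → ℝ) : ∑ k, c k • Y k x ∈ D x := by
    rw [← hYD x hx]
    exact Submodule.sum_mem _ fun j _ => Submodule.smul_mem _ _ (Submodule.subset_span ⟨j, rfl⟩)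
  have hinj (x) (hx : x ∈ O) : Function.Injective (T x) := by
    rw [injective_iff_map_eq_zero]
    intro c hc
    have h1 := hcompl x hx _ (hmem x hx c) fun i => by rw [← hTapp, hc]; rfl
    exact funext (Fintype.linearIndependent_iff.1 (hYlin x hx) c h1)
  have hsurj (x) (j : Fin q) : ∃ c, x ∈ O → T x c = Pi.single j 1 := by
    by_cases hx : x ∈ O
    · obtain ⟨c, hc⟩ := LinearMap.injective_iff_surjective (f := (T x : (Fin q → ℝ) →ₗ[ℝ] _)).1
        (hinj x hx) (Pi.single j 1)
      exact ⟨c, fun _ => hc⟩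
    · exact ⟨0, fun h => (hx h).elim⟩
  choose c hc using hsurj
  let R : Fin q → E → E := fun j x => ∑ k, c x j k • Y k x
  have hRD (j x) (hx : x ∈ O) : R j x ∈ D x := hmem x hx _
  have hηR (i j x) (hx : x ∈ O) : η i x (R j x) = if i = j then 1 else 0 := by
    rw [← hTapp, hc x j hx, Pi.single_apply]
  have hr1 : ((1 : ℕ∞) : WithTop ℕ∞) ≤ (r + 1 : ℕ∞) := by exact_mod_cast le_add_self
  refine ⟨R, fun j => ?_, hRD, hηR⟩
  -- For r = 0 the C^1 frame Y and the C^1 forms give a C^1 square system for the coefficients of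
  -- R_j. For r ≥ 1 that frame is too rough, so R_j is characterized without it by λ_i(v) = δ_ij and
  -- dλ_{i₀}(v, ·) = 0, an injective system with C^r coefficients.
  rcases eq_or_ne r 0 with rfl | hr
  · rw [max_eq_right zero_le_one]
    have hTc : ContDiffOn ℝ 1 T O := by
      rw [contDiffOn_clm_apply]
      intro y
      rw [contDiffOn_pi]
      intro i
      simp only [hTapp]
      exact ((hη i).of_le hr1).clm_apply (ContDiffOn.sum fun k _ => contDiffOn_const.smul (hY k))
    have hcc : ContDiffOn ℝ 1 (fun x => c x j) O :=
      contDiffOn_of_clm_apply_eq hO hTc hinj (contDiffOn_const (c := Pi.single j (1 : ℝ)))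
        fun x hx => hc x j hx
    exact ContDiffOn.sum fun k _ => ((contDiff_apply ℝ ℝ k).comp_contDiffOn hcc).smul (hY k)
  · rw [max_eq_left (Order.one_le_iff_ne_zero.2 hr)]
    let S : E → E →L[ℝ] (Fin q → ℝ) × (E →L[ℝ] ℝ) := fun x =>
      (ContinuousLinearMap.pi fun i => η i x).prod
        (fderiv ℝ (η i₀) x - (fderiv ℝ (η i₀) x).flip)
    have hSc : ContDiffOn ℝ r S O := by
      have hd : ContDiffOn ℝ r (fderiv ℝ (η i₀)) O :=
        (hη i₀).fderiv_of_isOpen hO (by push_cast; exact le_rfl)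
      rw [contDiffOn_clm_apply]
      intro y
      refine ContDiffOn.prodMk ?_ ?_
      · rw [contDiffOn_pi]
        intro i
        exact ((hη i).of_le (by exact_mod_cast le_self_add)).clm_apply contDiffOn_const
      · rw [contDiffOn_clm_apply]
        intro z
        exact ((hd.clm_apply contDiffOn_const).clm_apply contDiffOn_const).sub
          ((hd.clm_apply contDiffOn_const).clm_apply contDiffOn_const)
    refine contDiffOn_of_clm_apply_eq hO hSc (fun x hx => ?_)
      (contDiffOn_const (c := (Pi.single j (1 : ℝ), (0 : E →L[ℝ] ℝ)))) fun x hx => ?_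
    · rw [injective_iff_map_eq_zero]
      intro v hv
      have h1 : (fun i => η i x v) = 0 := congrArg Prod.fst hv
      have h2 : fderiv ℝ (η i₀) x v - (fderiv ℝ (η i₀) x).flip v = 0 := congrArg Prod.snd hv
      exact hcompl x hx v ((hD i₀ x hx v).2 fun w => congrArg (fun A : E →L[ℝ] ℝ => A w) h2)
        fun i => congrFun h1 i
    · refine Prod.ext ?_ ?_
      · ext i
        change η i x (R j x) = _
        rw [hηR i j x hx]
        exact (Pi.single_apply j (1 : ℝ) i).symm
      · exact ContinuousLinearMap.ext fun w => (hD i₀ x hx (R j x)).1 (hRD j x hx) w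

end ContactFoliation

end

/-! ### Forms, fields and exterior derivatives in charts -/

noncomputable section

namespace ContactFoliation

open Filter Topology

variable {E : Type*} [NormedAddCommGroup E] [NormedSpace ℝ E]
  {M : Type*} [TopologicalSpace M] [ChartedSpace E M] [IsManifold 𝓘(ℝ, E) ∞ M]

theorem mdifferentiableAt_extChartAt_symm' {p : M} {x : E}
    (hx : x ∈ (extChartAt 𝓘(ℝ, E) p).target) :
    MDifferentiableAt 𝓘(ℝ, E) 𝓘(ℝ, E) (extChartAt 𝓘(ℝ, E) p).symm x :=
  ((contMDiffOn_extChartAt_symm (n := 1) p).contMDiffAt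
    ((isOpen_extChartAt_target p).mem_nhds hx)).mdifferentiableAt (by simp)

theorem mdifferentiableAt_extChartAt' {p p' : M} (hp : p' ∈ (extChartAt 𝓘(ℝ, E) p).source) :
    MDifferentiableAt 𝓘(ℝ, E) 𝓘(ℝ, E) (extChartAt 𝓘(ℝ, E) p) p' :=
  mdifferentiableAt_extChartAt (by rwa [extChartAt_source] at hp)

theorem mfderiv_symm_mfderiv_extChartAt {p p' : M} (hp : p' ∈ (extChartAt 𝓘(ℝ, E) p).source)
    (v : TangentSpace 𝓘(ℝ, E) p') :
    (mfderiv 𝓘(ℝ, E) 𝓘(ℝ, E) (extChartAt 𝓘(ℝ, E) p).symm (extChartAt 𝓘(ℝ, E) p p')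
      (mfderiv 𝓘(ℝ, E) 𝓘(ℝ, E) (extChartAt 𝓘(ℝ, E) p) p' v) : E) = v := by
  have h := mfderivWithin_extChartAt_symm_comp_mfderiv_extChartAt (I := 𝓘(ℝ, E))
    ((extChartAt 𝓘(ℝ, E) p).map_source hp)
  rw [ModelWithCorners.range_eq_univ, mfderivWithin_univ,
    (extChartAt 𝓘(ℝ, E) p).left_inv hp] at h
  exact congrArg (fun A : E →L[ℝ] E => A v) h

theorem mfderiv_comp_extChartAt {G : Type*} [NormedAddCommGroup G] [NormedSpace ℝ G] {f : E → G}
    {p p' : M} (hp : p' ∈ (extChartAt 𝓘(ℝ, E) p).source)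
    (hf : DifferentiableAt ℝ f (extChartAt 𝓘(ℝ, E) p p')) (v : TangentSpace 𝓘(ℝ, E) p') :
    mfderiv 𝓘(ℝ, E) 𝓘(ℝ, G) (fun p' => f (extChartAt 𝓘(ℝ, E) p p')) p' v =
      fderiv ℝ f (extChartAt 𝓘(ℝ, E) p p')
        (mfderiv 𝓘(ℝ, E) 𝓘(ℝ, E) (extChartAt 𝓘(ℝ, E) p) p' v) := by
  have h := mfderiv_comp (I := 𝓘(ℝ, E)) (I' := 𝓘(ℝ, E)) (I'' := 𝓘(ℝ, G)) p' (g := f)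
    hf.mdifferentiableAt (mdifferentiableAt_extChartAt' hp)
  rw [mfderiv_eq_fderiv] at h
  exact congrArg (fun A : E →L[ℝ] G => A v) h

theorem form_apply_eq_oneFormInChart (η : OneForm E M) {p p' : M}
    (hp : p' ∈ (extChartAt 𝓘(ℝ, E) p).source) (v : TangentSpace 𝓘(ℝ, E) p') :
    η p' v = oneFormInChart η p (extChartAt 𝓘(ℝ, E) p p')
      (mfderiv 𝓘(ℝ, E) 𝓘(ℝ, E) (extChartAt 𝓘(ℝ, E) p) p' v) := by
  -- The base points agree only propositionally; since every tangent space is E by definition, the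
  -- equality can be substituted.
  have key (p'' : M) (h : p'' = p') (w : E) (hw : w = v) : (η p'' : E →L[ℝ] ℝ) w = η p' v := by
    subst h hw
    rfl
  exact (key _ ((extChartAt 𝓘(ℝ, E) p).left_inv hp) _
    (mfderiv_symm_mfderiv_extChartAt hp v)).symm

/-- The trivialization of the cotangent bundle at p is induced by the chart at p, so the section
read in it is the chart expression. -/
theorem contDiffOn_oneFormInChart {k : ℕ∞} {η : OneForm E M} (hη : IsOneFormOfClass k η) (p : M) :
    ContDiffOn ℝ k (oneFormInChart η p) (extChartAt 𝓘(ℝ, E) p).target := by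
  have h1 := (Bundle.Trivialization.contMDiffOn_iff
    (e := trivializationAt (E →L[ℝ] ℝ)
      (fun p : M => TangentSpace 𝓘(ℝ, E) p →L[ℝ] Bundle.Trivial M ℝ p) p)
    (s := (chartAt E p).source) (fun p' hp' => by
      rw [Bundle.Trivialization.mem_source]
      simpa [hom_trivializationAt_baseSet] using hp')).1 (hη.contMDiffOn)
  have h2 := h1.2.comp (s := (extChartAt 𝓘(ℝ, E) p).target)
    (contMDiffOn_extChartAt_symm (n := k) p) (fun x hx => by
      have := (extChartAt 𝓘(ℝ, E) p).map_target hx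
      rwa [extChartAt_source] at this)
  rw [contMDiffOn_iff_contDiffOn] at h2
  refine h2.congr fun x hx => ?_
  have hs : (extChartAt 𝓘(ℝ, E) p).symm x ∈ (chartAt E p).source := by
    have := (extChartAt 𝓘(ℝ, E) p).map_target hx
    rwa [extChartAt_source] at this
  refine ContinuousLinearMap.ext fun v => ?_
  simp only [Function.comp_apply, hom_trivializationAt_apply, ContinuousLinearMap.inCoordinates]
  rw [TangentBundle.symmL_trivializationAt hs, (extChartAt 𝓘(ℝ, E) p).right_inv hx,
    ModelWithCorners.range_eq_univ, mfderivWithin_univ]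
  simp [oneFormInChart]

theorem contDiffOn_vectorFieldInChart {k : ℕ∞} {U : Set M} {X : ∀ p : M, TangentSpace 𝓘(ℝ, E) p}
    (hX : ContMDiffOn 𝓘(ℝ, E) 𝓘(ℝ, E).tangent k
      (fun p => (⟨p, X p⟩ : TangentBundle 𝓘(ℝ, E) M)) U) (p : M) :
    ContDiffOn ℝ k (fun x => (mfderiv 𝓘(ℝ, E) 𝓘(ℝ, E) (extChartAt 𝓘(ℝ, E) p)
      ((extChartAt 𝓘(ℝ, E) p).symm x) (X ((extChartAt 𝓘(ℝ, E) p).symm x)) : E))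
      ((extChartAt 𝓘(ℝ, E) p).target ∩ (extChartAt 𝓘(ℝ, E) p).symm ⁻¹' U) := by
  have h1 := (Bundle.Trivialization.contMDiffOn_iff
    (e := trivializationAt E (TangentSpace 𝓘(ℝ, E)) p)
    (s := U ∩ (chartAt E p).source) (fun p' hp' => by
      rw [Bundle.Trivialization.mem_source]
      simpa using hp'.2)).1 (hX.mono inter_subset_left)
  have hs {x} (hx : x ∈ (extChartAt 𝓘(ℝ, E) p).target) :
      (extChartAt 𝓘(ℝ, E) p).symm x ∈ (chartAt E p).source := by
    have := (extChartAt 𝓘(ℝ, E) p).map_target hx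
    rwa [extChartAt_source] at this
  have h2 := h1.2.comp
    (s := (extChartAt 𝓘(ℝ, E) p).target ∩ (extChartAt 𝓘(ℝ, E) p).symm ⁻¹' U)
    ((contMDiffOn_extChartAt_symm (n := k) p).mono inter_subset_left)
    (fun x hx => ⟨hx.2, hs hx.1⟩)
  rw [contMDiffOn_iff_contDiffOn] at h2
  refine h2.congr fun x hx => ?_
  refine (congrArg (fun A : E →L[ℝ] E => A (X ((extChartAt 𝓘(ℝ, E) p).symm x)))
    (TangentBundle.continuousLinearMapAt_trivializationAt (hs hx.1)).symm).trans ?_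
  exact congrFun (Bundle.Trivialization.coe_linearMapAt_of_mem (R := ℝ)
    (trivializationAt E (TangentSpace 𝓘(ℝ, E)) p) (by simpa using hs hx.1)) _

/-- The exterior derivative of a `1`-form may be computed in any chart of the atlas. -/
theorem extDerivOneForm_eq {k : ℕ∞} (hk : 1 ≤ k) {η : OneForm E M} (hη : IsOneFormOfClass k η)
    {p p' : M} (hp : p' ∈ (extChartAt 𝓘(ℝ, E) p).source) (v w : TangentSpace 𝓘(ℝ, E) p') :
    extDerivOneForm η p' v w =
      fderiv ℝ (oneFormInChart η p) (extChartAt 𝓘(ℝ, E) p p')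
          (mfderiv 𝓘(ℝ, E) 𝓘(ℝ, E) (extChartAt 𝓘(ℝ, E) p) p' v)
          (mfderiv 𝓘(ℝ, E) 𝓘(ℝ, E) (extChartAt 𝓘(ℝ, E) p) p' w) -
        fderiv ℝ (oneFormInChart η p) (extChartAt 𝓘(ℝ, E) p p')
          (mfderiv 𝓘(ℝ, E) 𝓘(ℝ, E) (extChartAt 𝓘(ℝ, E) p) p' w)
          (mfderiv 𝓘(ℝ, E) 𝓘(ℝ, E) (extChartAt 𝓘(ℝ, E) p) p' v) := by
  have hkne : (k : WithTop ℕ∞) ≠ 0 := by exact_mod_cast (zero_lt_one.trans_le hk).ne'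
  set e := extChartAt 𝓘(ℝ, E) p with he
  set e' := extChartAt 𝓘(ℝ, E) p' with he'
  have hdiff (p : M) {x : E} (hx : x ∈ (extChartAt 𝓘(ℝ, E) p).target) :
      DifferentiableAt ℝ (oneFormInChart η p) x :=
    ((contDiffOn_oneFormInChart hη p).contDiffAt
      ((isOpen_extChartAt_target p).mem_nhds hx)).differentiableAt hkne
  let φ : E → E := fun x => e' (e.symm x)
  have hx : e p' ∈ e.target := e.map_source hp
  have hxs : e.symm (e p') = p' := e.left_inv hp
  have hO : IsOpen (e.target ∩ e.symm ⁻¹' e'.source) :=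
    (continuousOn_extChartAt_symm p).isOpen_inter_preimage (isOpen_extChartAt_target p)
      (isOpen_extChartAt_source p')
  have hxO : e p' ∈ e.target ∩ e.symm ⁻¹' e'.source := by
    refine ⟨hx, ?_⟩
    rw [mem_preimage, hxs]
    exact mem_extChartAt_source p'
  have hφ : ContDiffAt ℝ 1 φ (e p') := by
    have h1 : ContMDiffOn 𝓘(ℝ, E) 𝓘(ℝ, E) 1 φ (e.target ∩ e.symm ⁻¹' e'.source) := by
      have h2 : ContMDiffOn 𝓘(ℝ, E) 𝓘(ℝ, E) 1 e' e'.source := by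
        rw [he', extChartAt_source]
        exact contMDiffOn_extChartAt
      exact h2.comp ((contMDiffOn_extChartAt_symm (n := 1) p).mono inter_subset_left)
        fun x hx => hx.2
    exact (contMDiffOn_iff_contDiffOn.1 h1).contDiffAt (hO.mem_nhds hxO)
  have hφd {y} (hy : y ∈ e.target ∩ e.symm ⁻¹' e'.source) (v : E) :
      fderiv ℝ φ y v = mfderiv 𝓘(ℝ, E) 𝓘(ℝ, E) e' (e.symm y)
        (mfderiv 𝓘(ℝ, E) 𝓘(ℝ, E) e.symm y v) := by
    have h1 := mfderiv_comp (I := 𝓘(ℝ, E)) (I' := 𝓘(ℝ, E)) (I'' := 𝓘(ℝ, E)) y (g := e')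
      (f := e.symm) (mdifferentiableAt_extChartAt' hy.2)
      (mdifferentiableAt_extChartAt_symm' hy.1)
    rw [mfderiv_eq_fderiv] at h1
    exact congrArg (fun A : E →L[ℝ] E => A v) h1
  -- The two chart expressions differ by pullback along the transition map φ.
  have hpull : ∀ᶠ y in 𝓝 (e p'), oneFormInChart η p y =
      (oneFormInChart η p' (φ y)).comp (fderiv ℝ φ y) := by
    filter_upwards [hO.mem_nhds hxO] with y hy
    refine ContinuousLinearMap.ext fun v => ?_
    rw [ContinuousLinearMap.comp_apply, hφd hy]
    exact form_apply_eq_oneFormInChart η hy.2 _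
  have hφx : φ (e p') = e' p' := by simp only [φ, hxs]
  have hη' : DifferentiableAt ℝ (oneFormInChart η p') (φ (e p')) := by
    rw [hφx]
    exact hdiff p' (mem_extChartAt_target p')
  have hφv (v : TangentSpace 𝓘(ℝ, E) p') : (fderiv ℝ φ (e p')
      (mfderiv 𝓘(ℝ, E) 𝓘(ℝ, E) e p' v) : E) = mfderiv 𝓘(ℝ, E) 𝓘(ℝ, E) e' p' v := by
    refine (hφd hxO _).trans ?_
    have key (p'' : M) (h : p'' = p') (w : E) (hw : w = v) :
        (mfderiv 𝓘(ℝ, E) 𝓘(ℝ, E) e' p'' : E →L[ℝ] E) w =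
          mfderiv 𝓘(ℝ, E) 𝓘(ℝ, E) e' p' v := by
      subst h hw
      rfl
    exact key _ hxs _ (mfderiv_symm_mfderiv_extChartAt hp v)
  have := fderiv_skew_of_eventuallyEq_pullback hφ hη' (hdiff p hx) hpull
    (mfderiv 𝓘(ℝ, E) 𝓘(ℝ, E) e p' v) (mfderiv 𝓘(ℝ, E) 𝓘(ℝ, E) e p' w)
  rw [hφv, hφv, hφx] at this
  exact this.symm

end ContactFoliation

end

/-! ### Transfer of the q-contact structure to a chart -/

noncomputable section

namespace ContactFoliation

open Filter Topology

variable {E : Type*} [NormedAddCommGroup E] [NormedSpace ℝ E]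
  {M : Type*} [TopologicalSpace M] [ChartedSpace E M] [IsManifold 𝓘(ℝ, E) ∞ M]

namespace QContactStructure

theorem exists_chartDeriv_equiv {r : ℕ∞} {n q : ℕ} (S : QContactStructure (r + 1) n q E M)
    {p p' : M} (hp : p' ∈ (extChartAt 𝓘(ℝ, E) p).source) :
    ∃ L : E ≃L[ℝ] E,
      (∀ v : E, L v = mfderiv 𝓘(ℝ, E) 𝓘(ℝ, E) (extChartAt 𝓘(ℝ, E) p) p' v) ∧
      (∀ i (v : E), oneFormInChart (S.form i) p (extChartAt 𝓘(ℝ, E) p p') (L v) =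
        S.form i p' v) ∧
      (∀ i (v : E), v ∈ S.reeb p' ↔ ∀ w,
        fderiv ℝ (oneFormInChart (S.form i) p) (extChartAt 𝓘(ℝ, E) p p') (L v) w -
          fderiv ℝ (oneFormInChart (S.form i) p) (extChartAt 𝓘(ℝ, E) p p') w (L v) = 0) := by
  obtain ⟨L, hL⟩ : ∃ L : E ≃L[ℝ] E, (L : E →L[ℝ] E) =
      mfderiv 𝓘(ℝ, E) 𝓘(ℝ, E) (extChartAt 𝓘(ℝ, E) p) p' :=
    isInvertible_mfderiv_extChartAt hp
  have hL' (v : E) : L v = mfderiv 𝓘(ℝ, E) 𝓘(ℝ, E) (extChartAt 𝓘(ℝ, E) p) p' v :=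
    congrArg (fun A : E →L[ℝ] E => A v) hL
  have hd (i) (v w : E) : extDerivOneForm (S.form i) p' v w =
      fderiv ℝ (oneFormInChart (S.form i) p) (extChartAt 𝓘(ℝ, E) p p') (L v) (L w) -
        fderiv ℝ (oneFormInChart (S.form i) p) (extChartAt 𝓘(ℝ, E) p p') (L w) (L v) := by
    refine (extDerivOneForm_eq le_add_self (S.form_class i) hp v w).trans ?_
    rw [hL' v, hL' w]
  refine ⟨L, hL', fun i v => ?_, fun i v => ?_⟩
  · rw [hL']
    exact (form_apply_eq_oneFormInChart (S.form i) hp v).symm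
  · refine (S.mem_reeb_iff i p' v).trans ⟨fun h w => ?_, fun h w => (hd i v w).trans (h _)⟩
    have := (hd i v (L.symm w)).symm.trans (h (L.symm w))
    rwa [L.apply_symm_apply] at this

/-- Supplies the hypotheses of `exists_local_normal_form`. -/
theorem exists_reeb_fields_inChart {r : ℕ∞} {n q : ℕ} (S : QContactStructure (r + 1) n q E M)
    [FiniteDimensional ℝ E] (hdim : finrank ℝ E = 2 + q) (p₀ : M) :
    ∃ (O : Set E) (R : Fin q → E → E), IsOpen O ∧ extChartAt 𝓘(ℝ, E) p₀ p₀ ∈ O ∧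
      O ⊆ (extChartAt 𝓘(ℝ, E) p₀).target ∧ (∀ j, ContDiffOn ℝ (max r 1 : ℕ∞) (R j) O) ∧
      (∀ i j, ∀ x ∈ O, oneFormInChart (S.form i) p₀ x (R j x) = if i = j then 1 else 0) ∧
      (∀ i j, ∀ x ∈ O, ∀ w, fderiv ℝ (oneFormInChart (S.form i) p₀) x (R j x) w -
        fderiv ℝ (oneFormInChart (S.form i) p₀) x w (R j x) = 0) ∧
      ∀ i, ∀ x ∈ O, ∃ v w, fderiv ℝ (oneFormInChart (S.form i) p₀) x v w -
        fderiv ℝ (oneFormInChart (S.form i) p₀) x w v ≠ 0 := by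
  set e := extChartAt 𝓘(ℝ, E) p₀ with he
  obtain ⟨U, hU, hpU, X, hX, hXs⟩ := S.reeb_class p₀
  let Xc : Fin q → M → E := X
  have hXlin {p} (hp : p ∈ U) : LinearIndependent ℝ fun j => Xc j p := (hXs p hp).1
  have hXspan {p} (hp : p ∈ U) :
      Submodule.span ℝ (range fun j => Xc j p) = (S.reeb p : Submodule ℝ E) := (hXs p hp).2
  let O : Set E := e.target ∩ e.symm ⁻¹' U
  have hO : IsOpen O := (continuousOn_extChartAt_symm p₀).isOpen_inter_preimage
    (isOpen_extChartAt_target p₀) hU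
  have hx₀ : e p₀ ∈ O := by
    refine ⟨mem_extChartAt_target p₀, ?_⟩
    rw [mem_preimage, he, extChartAt_to_inv]
    exact hpU
  have hpt {x} (hx : x ∈ O) : ∃ p' ∈ e.source, p' ∈ U ∧ e p' = x :=
    ⟨e.symm x, e.map_target hx.1, hx.2, e.right_inv hx.1⟩
  let Y : Fin q → E → E := fun j x =>
    mfderiv 𝓘(ℝ, E) 𝓘(ℝ, E) e (e.symm x) (X j (e.symm x))
  have hY (j) {p'} (hp' : p' ∈ e.source) :
      Y j (e p') = mfderiv 𝓘(ℝ, E) 𝓘(ℝ, E) e p' (X j p') :=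
    congrArg (fun p'' => (mfderiv 𝓘(ℝ, E) 𝓘(ℝ, E) e p'' (X j p'') : E)) (e.left_inv hp')
  let D : E → Submodule ℝ E := fun x => Submodule.span ℝ (range fun j => Y j x)
  have hη (i) : ContDiffOn ℝ (r + 1 : ℕ∞) (oneFormInChart (S.form i) p₀) O :=
    (contDiffOn_oneFormInChart (S.form_class i) p₀).mono inter_subset_left
  have hYL {p'} (hp' : p' ∈ e.source) {L : E ≃L[ℝ] E}
      (hL : ∀ v : E, L v = mfderiv 𝓘(ℝ, E) 𝓘(ℝ, E) e p' v) :
      (fun j => Y j (e p')) = fun j => (L : E →ₗ[ℝ] E) (Xc j p') := by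
    funext j
    rw [hY j hp']
    exact (hL _).symm
  have hDL {p'} (hp' : p' ∈ e.source) (hpU : p' ∈ U) {L : E ≃L[ℝ] E}
      (hL : ∀ v : E, L v = mfderiv 𝓘(ℝ, E) 𝓘(ℝ, E) e p' v) (u : E) :
      L u ∈ D (e p') ↔ u ∈ S.reeb p' := by
    have h1 : D (e p') = (Submodule.span ℝ (range fun j => Xc j p')).map (L : E →ₗ[ℝ] E) := by
      rw [Submodule.map_span, ← range_comp]
      exact congrArg (fun Z : Fin q → E => Submodule.span ℝ (range Z)) (hYL hp' hL)
    rw [h1, hXspan hpU]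
    constructor
    · rintro ⟨u', hu', h⟩
      have : u' = u := L.injective h
      exact this ▸ hu'
    · exact fun hu => ⟨u, hu, rfl⟩
  have hDiff (i) (x) (hx : x ∈ O) (v : E) : v ∈ D x ↔ ∀ w,
      fderiv ℝ (oneFormInChart (S.form i) p₀) x v w -
        fderiv ℝ (oneFormInChart (S.form i) p₀) x w v = 0 := by
    obtain ⟨p', hp', hp'U, rfl⟩ := hpt hx
    obtain ⟨L, hL, -, hreeb⟩ := S.exists_chartDeriv_equiv hp'
    have h1 := (hDL hp' hp'U hL (L.symm v)).trans (hreeb i (L.symm v))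
    rwa [L.apply_symm_apply] at h1
  obtain ⟨R, hR, hRD, hηR⟩ := exists_reeb_fields (D := D) ⟨0, S.q_pos⟩ hO hη
    (fun j => contDiffOn_vectorFieldInChart (hX j) p₀) (fun x hx => by
      obtain ⟨p', hp', hp'U, rfl⟩ := hpt hx
      obtain ⟨L, hL, -⟩ := S.exists_chartDeriv_equiv hp'
      have h2 := (hXlin hp'U).map' (L : E →ₗ[ℝ] E) (LinearMap.ker_eq_bot.2 L.injective)
      exact (congrArg (fun Z : Fin q → E => LinearIndependent ℝ Z) (hYL hp' hL)).mpr h2)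
    (fun x _ => rfl) hDiff
    (fun x hx v hv hv0 => by
      obtain ⟨p', hp', hp'U, rfl⟩ := hpt hx
      obtain ⟨L, hL, hform, -⟩ := S.exists_chartDeriv_equiv hp'
      have h1 : L.symm v ∈ S.reeb p' := by
        rw [← hDL hp' hp'U hL, L.apply_symm_apply]
        exact hv
      have h2 : L.symm v ∈ S.xi p' := (S.mem_xi_iff p' _).2 fun i => by
        refine (hform i (L.symm v)).symm.trans ?_
        rw [L.apply_symm_apply]
        exact hv0 i
      have h3 : L.symm v = 0 := Submodule.disjoint_def.1 (S.isCompl p').disjoint _ h1 h2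
      exact L.symm.map_eq_zero_iff.1 h3)
  refine ⟨O, R, hO, hx₀, inter_subset_left, hR, hηR,
    fun i j x hx => (hDiff i x hx _).1 (hRD j x hx), fun i x hx => ?_⟩
  -- If dλ_i vanished at a point, its kernel, of rank q, would be the whole space of dimension q +
  -- 2.
  by_contra! hcon
  obtain ⟨p', hp', hp'U, rfl⟩ := hpt hx
  obtain ⟨L, hL, -, hreeb⟩ := S.exists_chartDeriv_equiv hp'
  have htop : (⊤ : Submodule ℝ E) ≤ Submodule.span ℝ (range fun j => Xc j p') := by
    intro v _
    rw [hXspan hp'U]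
    exact (hreeb i v).2 fun w => hcon _ _
  have h2 := finrank_span_eq_card (hXlin hp'U)
  rw [top_le_iff.1 htop, finrank_top, hdim, Fintype.card_fin] at h2
  omega

end QContactStructure

end ContactFoliation

end

/-! ### The normal form on the manifold -/

theorem mainTheorem12
    {E : Type*} [NormedAddCommGroup E] [NormedSpace ℝ E]
    {M : Type*} [TopologicalSpace M] [ChartedSpace E M] [IsManifold 𝓘(ℝ, E) ∞ M]
    {r : ℕ∞} {n q : ℕ}
    (S : ContactFoliation.QContactStructure (r + 1) n q E M)
    (hdim : finrank ℝ E = 2 + q) (p₀ : M) :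
    -- the coordinates are `φ p = (x, y, (z_1, …, z_q))` on `U = φ.source`
    ∃ (φ : OpenPartialHomeomorph M (ℝ × ℝ × (Fin q → ℝ))) (a : Fin q → M → ℝ),
      p₀ ∈ φ.source ∧
      ContMDiffOn 𝓘(ℝ, E) 𝓘(ℝ, ℝ × ℝ × (Fin q → ℝ)) r φ φ.source ∧
      ContMDiffOn 𝓘(ℝ, ℝ × ℝ × (Fin q → ℝ)) 𝓘(ℝ, E) r φ.symm φ.target ∧
      -- `y` and the `z_i` are of class `C^1` even when `r = 0`
      ContMDiffOn 𝓘(ℝ, E) 𝓘(ℝ, ℝ) 1 (fun p => (φ p).2.1) φ.source ∧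
      (∀ i, ContMDiffOn 𝓘(ℝ, E) 𝓘(ℝ, ℝ) 1 (fun p => (φ p).2.2 i) φ.source) ∧
      -- the functions `a_i`
      (∀ i, ContMDiffOn 𝓘(ℝ, E) 𝓘(ℝ, ℝ) r (a i) φ.source) ∧
      (∀ i, S.LeafwiseConstantOn (a i) φ.source) ∧
      -- `∂_x a_i` exists and does not vanish
      (∀ i, ∀ p ∈ φ.source,
        deriv (fun s : ℝ => a i (φ.symm (s, (φ p).2))) (φ p).1 ≠ 0) ∧
      -- `λ_i = dz_i + a_i dy`
      (∀ i, ∀ p ∈ φ.source, ∀ v : TangentSpace 𝓘(ℝ, E) p,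
        S.form i p v =
          ContactFoliation.differential (fun p => (φ p).2.2 i) p v +
            a i p * ContactFoliation.differential (fun p => (φ p).2.1) p v) ∧
      -- `a_1 = x`
      (∀ p ∈ φ.source, a ⟨0, S.q_pos⟩ p = (φ p).1) := by
  -- `finrank` is 0 in infinite dimension, so a positive value forces finite dimension.
  have : FiniteDimensional ℝ E := FiniteDimensional.of_finrank_pos (by omega)
  obtain ⟨O, R, hO, hx₀, hOt, hR, hηR, hker, hne⟩ := S.exists_reeb_fields_inChart hdim p₀
  obtain ⟨ψ, A, π, hx₀ψ, hψO, hψ, hψs, hψy, hψz, hπ, hA, hπker, hderiv, hform, hfst⟩ :=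
    ContactFoliation.exists_local_normal_form hdim (le_max_right r 1) (le_max_left r 1)
      ⟨0, S.q_pos⟩ hO hx₀
      (fun i => (ContactFoliation.contDiffOn_oneFormInChart (S.form_class i) p₀).mono hOt) hR hηR
      hker hne
  set e := extChartAt 𝓘(ℝ, E) p₀ with he
  have hm1 : (1 : WithTop ℕ∞) ≤ (max r 1 : ℕ∞) := by exact_mod_cast le_max_right r 1
  have hmr : (r : WithTop ℕ∞) ≤ (max r 1 : ℕ∞) := by exact_mod_cast le_max_left r 1
  let φ : OpenPartialHomeomorph M (ℝ × ℝ × (Fin q → ℝ)) := (chartAt E p₀).trans ψ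
  have hφ (p) : φ p = ψ (e p) := rfl
  have hφs (y) : φ.symm y = e.symm (ψ.symm y) := rfl
  have hsrc {p} (hp : p ∈ φ.source) : p ∈ e.source ∧ e p ∈ ψ.source := by
    simp only [φ, OpenPartialHomeomorph.trans_source] at hp
    refine ⟨?_, hp.2⟩
    rw [he, extChartAt_source]
    exact hp.1
  have htgt {y} (hy : y ∈ φ.target) : y ∈ ψ.target ∧ ψ.symm y ∈ e.target :=
    ⟨hy.1, hOt (hψO (ψ.map_target hy.1))⟩
  have hcomp {G : Type} [NormedAddCommGroup G] [NormedSpace ℝ G] {k : ℕ∞} {f : E → G}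
      (hf : ContDiffOn ℝ k f ψ.source) :
      ContMDiffOn 𝓘(ℝ, E) 𝓘(ℝ, G) k (fun p => f (e p)) φ.source := by
    refine hf.contMDiffOn.comp (t := ψ.source) (contMDiffOn_extChartAt.mono fun p hp => ?_)
      fun p hp => (hsrc hp).2
    have := (hsrc hp).1
    rwa [he, extChartAt_source] at this
  have hd {G : Type} [NormedAddCommGroup G] [NormedSpace ℝ G] {f : E → G}
      (hf : ContDiffOn ℝ 1 f ψ.source) {x} (hx : x ∈ ψ.source) : DifferentiableAt ℝ f x :=
    (hf.contDiffAt (ψ.open_source.mem_nhds hx)).differentiableAt (by simp)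
  refine ⟨φ, fun i p => A i (π (e p)), ?_, hcomp hψ, ?_, hcomp (k := 1) hψy,
    fun i => hcomp (k := 1) (hψz i), fun i => ?_, fun i => ?_, fun i p hp => ?_,
    fun i p hp v => ?_, fun p hp => hfst _ (hsrc hp).2⟩
  · simp only [φ, OpenPartialHomeomorph.trans_source]
    exact ⟨mem_chart_source E p₀, hx₀ψ⟩
  · exact (contMDiffOn_extChartAt_symm (n := r) p₀).comp
      (hψs.contMDiffOn.mono fun y hy => (htgt hy).1) fun y hy => (htgt hy).2
  · exact hcomp ((hA i).comp_contDiffOn (hπ.of_le hmr))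
  · rintro p p' ⟨γ, hγ, hγU, hγR, rfl, rfl⟩
    -- For r = 0 the a_i need not be differentiable, so constancy along a leaf is proved for the C^1
    -- map π, through which they factor.
    have hder (t) (ht : t ∈ Icc (0 : ℝ) 1) :
        HasDerivWithinAt (fun t => π (e (γ t))) 0 (Icc 0 1) t := by
      obtain ⟨hts, htψ⟩ := hsrc (hγU t ht)
      obtain ⟨L, hL, -, hreeb⟩ := S.exists_chartDeriv_equiv hts
      have hπd := hd (hπ.of_le hm1) htψ
      have h1 : MDifferentiableWithinAt 𝓘(ℝ, ℝ) 𝓘(ℝ, E) γ (Icc 0 1) t :=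
        (hγ t ht).mdifferentiableWithinAt (by simp)
      have h2 : MDifferentiableAt 𝓘(ℝ, E) 𝓘(ℝ, ℝ × ℝ) (fun p => π (e p)) (γ t) :=
        hπd.mdifferentiableAt.comp (γ t) (ContactFoliation.mdifferentiableAt_extChartAt' hts)
      have h3 := h2.hasMFDerivAt.comp_hasMFDerivWithinAt t h1.hasMFDerivWithinAt
      let f' : E →L[ℝ] ℝ × ℝ := mfderiv 𝓘(ℝ, E) 𝓘(ℝ, ℝ × ℝ) (fun p => π (e p)) (γ t)
      let γ' : ℝ →L[ℝ] E := mfderivWithin 𝓘(ℝ, ℝ) 𝓘(ℝ, E) γ (Icc 0 1) t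
      have h4 : HasFDerivWithinAt (fun t => π (e (γ t))) (f'.comp γ') (Icc 0 1) t :=
        hasMFDerivWithinAt_iff_hasFDerivWithinAt.1 h3
      replace h4 := h4.hasDerivWithinAt
      refine h4.congr_deriv ?_
      let u : E := mfderivWithin 𝓘(ℝ, ℝ) 𝓘(ℝ, E) γ (Icc 0 1) t (1 : ℝ)
      have h5 := ContactFoliation.mfderiv_comp_extChartAt hts hπd u
      refine h5.trans ?_
      have h6 := hπker _ htψ (L u) ((hreeb ⟨0, S.q_pos⟩ u).1 (hγR t ht))
      rw [hL u] at h6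
      exact h6
    have := ContactFoliation.eq_add_smul_of_hasDerivWithinAt_const hder 1
      (right_mem_Icc.2 zero_le_one)
    simp only [smul_zero, add_zero] at this
    simp only [this]
  · have hyt : φ p ∈ φ.target := φ.map_source hp
    have hev : (fun s : ℝ => A i (π (e (φ.symm (s, (φ p).2))))) =ᶠ[nhds (φ p).1]
        fun s => A i (π (ψ.symm (s, (ψ (e p)).2))) := by
      have hcs : ContinuousAt (fun s : ℝ => (s, (φ p).2)) (φ p).1 := by fun_prop
      filter_upwards [hcs.preimage_mem_nhds (φ.open_target.mem_nhds hyt)] with s hs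
      rw [hφs, e.right_inv (htgt hs).2, hφ]
    rw [hev.deriv_eq]
    exact hderiv i _ (hsrc hp).2
  · obtain ⟨hps, hpψ⟩ := hsrc hp
    refine (ContactFoliation.form_apply_eq_oneFormInChart (S.form i) hps v).trans ?_
    refine (hform i _ hpψ _).trans ?_
    have h1 := ContactFoliation.mfderiv_comp_extChartAt hps (hd (hψz i) hpψ) v
    have h2 := ContactFoliation.mfderiv_comp_extChartAt hps (hd hψy hpψ) v
    exact congrArg₂ (fun b c : ℝ => b + A i (π (e p)) * c) h1.symm h2.symm
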